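/- Let $\mathcal X,\mathcal Y,\hat{\mathcal X}$ be finite alphabets, $P_{X,Y}$ a probability distribution on $\mathcal X\times\mathcal Y$, $D_{\min}\le D_{\max}$ real numbers and $d:\mathcal X\times\hat{\mathcal X}\to[D_{\min},D_{\max}]$ a distortion function, extended to sequences by $d(x^n,\hat x^n)=\frac1n\sum_{i=1}^n d(x_i,\hat x_i)$. Let $(X_i,Y_i)$, $i\ge 1$, be i.i.d. with law $P_{X,Y}$, and let $I$ denote mutual information (with logarithms to a fixed base $b>1$). The single letter leakage function is $$L(D)=\min\{I(Y;\hat X)\;:\;P_{\hat X|X,Y}\text{ with }\mathbb E[d(X,\hat X)]\le D\},$$ with $L(D)=+\infty$ if there is no such $P_{\hat X|X,Y}$. Let $g:[D_{\min},D_{\max}]\to(0,1]$ be non-increasing and right-continuous, and for $n\ge1$ let $$L^{(G)}(n,g)=\min\Big\{\tfrac1n I(Y^n;\hat X^n)\;:\;P_{\hat X^n|X^n,Y^n}\text{ with }\mathbb P[d(X^n,\hat X^n)>D]\le g(D)\text{ for all }D\in[D_{\min},D_{\max}]\Big\},$$ where the minimum is over arbitrary (not necessarily memoryless) conditional distributions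 of $\hat X^n\in\hat{\mathcal X}^n$ given $(X^n,Y^n)$. If $L$ is bounded on $[D_{\min},D_{\max}]$, that is, $L(D)\le C$ for all $D\in[D_{\min},D_{\max}]$ and some real $C$, then the integral below exists, the sequence $L^{(G)}(n,g)$ converges as $n\to\infty$, and $$L^{(G)}(g):=\lim_{n\to\infty}L^{(G)}(n,g)=\int_{D_{\min}}^{D_{\max}}L(D)\,d(g(D)),$$ the Lebesgue–Stieltjes integral of $L$ with respect to the (positive) measure $\mu_g$ on $[D_{\min},D_{\max}]$ associated with $g$, namely the one with $\mu_g([D_{\min},D])=1-g(D)$ for all $D\in[D_{\min},D_{\max}]$; in particular $\mu_g(\{D_{\min}\})=1-g(D_{\min})$. -/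

import Mathlib

open Set Filter Topology MeasureTheory

noncomputable section

/-- `W` is a random mechanism (a conditional law `P_{Z|X,Y}`): for every `x, y` the function
`W x y` is a probability mass function on the finite alphabet `Z`. -/
def IsMechanism {X Y Z : Type*} [Fintype Z] (W : X → Y → Z → ℝ) : Prop :=
  ∀ x y, W x y ∈ stdSimplex ℝ Z

/-- The expectation `E[f(X,Z)]` when `(X,Y)` has mass function `P` and `Z` is drawn from the
mechanism `W` applied to `(X,Y)`. -/
def expect {X Y Z : Type*} [Fintype X] [Fintype Y] [Fintype Z]
    (P : X × Y → ℝ) (W : X → Y → Z → ℝ) (f : X → Z → ℝ) : ℝ :=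
  ∑ x, ∑ y, ∑ z, P (x, y) * W x y z * f x z

/-- The probability of the event `A` for the pair `(X,Z)`, where `(X,Y)` has mass function `P` and
`Z` is drawn from the mechanism `W` applied to `(X,Y)`. -/
def prob {X Y Z : Type*} [Fintype X] [Fintype Y] [Fintype Z]
    (P : X × Y → ℝ) (W : X → Y → Z → ℝ) (A : Set (X × Z)) : ℝ :=
  expect P W (fun x z => A.indicator (fun _ => (1 : ℝ)) (x, z))

/-- The mutual information, with logarithms to base `b`, of two random variables with joint mass
function `Q` (with the convention `0 log 0 = 0`). -/
def mutualInfo {Y Z : Type*} [Fintype Y] [Fintype Z] (b : ℝ) (Q : Y × Z → ℝ) : ℝ :=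
  ∑ y, ∑ z, Q (y, z) * Real.logb b (Q (y, z) / ((∑ z', Q (y, z')) * ∑ y', Q (y', z)))

/-- The leakage `I(Y;Z)`, where `(X,Y)` has mass function `P` and `Z` is drawn from the
mechanism `W` applied to `(X,Y)`. -/
def leakage {X Y Z : Type*} [Fintype X] [Fintype Y] [Fintype Z]
    (b : ℝ) (P : X × Y → ℝ) (W : X → Y → Z → ℝ) : ℝ :=
  mutualInfo b (fun yz : Y × Z => ∑ x, P (x, yz.1) * W x yz.1 yz.2)

/-- The mass function of `n` i.i.d. copies of `(X,Y) ∼ P`. -/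
def iidLaw {X Y : Type*} (P : X × Y → ℝ) (n : ℕ) : (Fin n → X) × (Fin n → Y) → ℝ :=
  fun xy => ∏ i, P (xy.1 i, xy.2 i)

/-- The distortion of sequences: the average of the letterwise distortions. -/
def seqDistortion {X Z : Type*} (d : X → Z → ℝ) (n : ℕ) (x : Fin n → X) (z : Fin n → Z) : ℝ :=
  (∑ i, d (x i) (z i)) / n

/-- The single letter leakage function: the minimum of `I(Y;Z)` over all mechanisms with
`E[d(X,Z)] ≤ D`, and `⊤` when there is no such mechanism. -/
def singleLetterLeakage {X Y Z : Type*} [Fintype X] [Fintype Y] [Fintype Z]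
    (b : ℝ) (P : X × Y → ℝ) (d : X → Z → ℝ) (D : ℝ) : EReal :=
  ⨅ W ∈ {W : X → Y → Z → ℝ | IsMechanism W ∧ expect P W d ≤ D}, ((leakage b P W : ℝ) : EReal)

/-- The mechanisms from `(Xⁿ,Yⁿ)` to `Zⁿ` with `P[d(Xⁿ,Zⁿ) > D] ≤ g(D)` for all
`D ∈ [Dmin, Dmax]`. -/
def feasibleMechanisms {X Y Z : Type*} [Fintype X] [Fintype Y] [Fintype Z]
    (P : X × Y → ℝ) (d : X → Z → ℝ) (Dmin Dmax : ℝ) (g : ℝ → ℝ) (n : ℕ) :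
    Set ((Fin n → X) → (Fin n → Y) → (Fin n → Z) → ℝ) :=
  {W | IsMechanism W ∧ ∀ D ∈ Icc Dmin Dmax,
    prob (iidLaw P n) W {xz | D < seqDistortion d n xz.1 xz.2} ≤ g D}

/-- The minimal leakage `(1/n) I(Yⁿ;Zⁿ)` over all general `n`-letter mechanisms whose complementary
distortion CDF is bounded by `g`, and `⊤` when there is no such mechanism. -/
def generalLeakage {X Y Z : Type*} [Fintype X] [Fintype Y] [Fintype Z]
    (b : ℝ) (P : X × Y → ℝ) (d : X → Z → ℝ) (Dmin Dmax : ℝ) (g : ℝ → ℝ) (n : ℕ) : EReal :=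
  ⨅ W ∈ feasibleMechanisms P d Dmin Dmax g n,
    ((1 / (n : ℝ) * leakage b (iidLaw P n) W : ℝ) : EReal)

/-- `g`, restricted to `[Dmin, Dmax]`, is a non-increasing right-continuous function
with values in `(0,1]`. Values of `g` outside this interval are irrelevant. -/
structure IsTailBound (Dmin Dmax : ℝ) (g : ℝ → ℝ) : Prop where
  antitoneOn : AntitoneOn g (Icc Dmin Dmax)
  rightCont : ∀ D ∈ Icc Dmin Dmax, ContinuousWithinAt g (Icc D Dmax) D
  mem_Ioc : ∀ D ∈ Icc Dmin Dmax, g D ∈ Ioc (0 : ℝ) 1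

/-- The Stieltjes function of `g`: it is `0` below `Dmin` (that is, `g` is extended by `1` there),
`1 - g` on `[Dmin, Dmax]`, and constant from `Dmax` on. -/
def IsTailBound.stieltjes {Dmin Dmax : ℝ} {g : ℝ → ℝ} (hg : IsTailBound Dmin Dmax g)
    (hD : Dmin ≤ Dmax) : StieltjesFunction ℝ where
  toFun D := if D < Dmin then 0 else 1 - g (min D Dmax)
  mono' := by
    intro u v huv
    have key : ∀ w, Dmin ≤ w → min w Dmax ∈ Icc Dmin Dmax := fun w hw =>
      ⟨le_min hw hD, min_le_right _ _⟩
    dsimp only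
    split_ifs with h1 h2 h2
    · exact le_rfl
    · have := (hg.mem_Ioc _ (key v (not_lt.1 h2))).2
      linarith
    · exact absurd (lt_of_le_of_lt huv h2) h1
    · have := hg.antitoneOn (key u (not_lt.1 h1)) (key v (not_lt.1 h2))
        (min_le_min_right Dmax huv)
      linarith
  right_continuous' := by
    intro u
    by_cases hu : u < Dmin
    · refine ContinuousAt.continuousWithinAt ?_
      have : (fun D => if D < Dmin then (0 : ℝ) else 1 - g (min D Dmax)) =ᶠ[𝓝 u] fun _ => 0 := by
        filter_upwards [Iio_mem_nhds hu] with w hw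
        exact if_pos hw
      exact continuousAt_const.congr this.symm
    · have hu' : Dmin ≤ u := not_lt.1 hu
      have hc : ContinuousWithinAt (fun D => 1 - g (min D Dmax)) (Ici u) u := by
        refine continuousWithinAt_const.sub ?_
        refine ContinuousWithinAt.comp (g := g) (f := fun D => min D Dmax)
          (t := Icc (min u Dmax) Dmax)
          (hg.rightCont _ ⟨le_min hu' hD, min_le_right _ _⟩) ?_ ?_
        · exact (continuous_id.min continuous_const).continuousWithinAt
        · intro w hw
          exact ⟨min_le_min_right Dmax hw, min_le_right _ _⟩
      refine hc.congr (fun w hw => ?_) ?_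
      · exact if_neg (not_lt.2 (hu'.trans hw))
      · exact if_neg hu

end

/-! Write `L` for the single letter leakage and `|q|` for the total mass of a measure `q`. Both
bounds are proved for a finite partition `t 0 = Dmin ≤ … ≤ t k = Dmax`; they become
Riemann–Stieltjes sums of `L`, which meet at the integral because `L` is continuous on the interval.

Converse. Label each outcome by the least level `u` whose `t u` dominates its distortion, and let `q
u` be the unnormalized average letter law on that cell. Testing the `n`-letter information against a
uniform mixture of product reverse channels, one per cell, gives at least `n` times the sum of the
`perspectiveInfo` of the cells, minus the log of the number of cells
(`sum_perspectiveInfo_cellType_le`). Each `q u` has `X × Y` marginal within `1/√n` of `|q u| P`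
(`abs_sum_cellType_sub_le`) and mean distortion at most `|q u| t u`. Compactness then bounds its
information below by `|q u| L(t u) - ε` (`exists_forall_le_perspectiveInfo`). Working with the
perspective instead of normalized laws makes this uniform even for cells of vanishing mass.
Summation by parts brings in the tail bound (`eventually_le_leakage`).

Achievability. Time-share memoryless mechanisms designed for the levels `t j`, with weights given by
the increments of `g`. By Chebyshev each exceeds its level with probability at most `δ`; positivity
of `g` allows this `δ` to be taken out of the weight of the top level, where `L` vanishes. Convexity
of mutual information in the channel bounds the leakage of the mixture
(`eventually_exists_leakage_le`). -/

/-! ### Gibbs' inequality and mutual information of finite measures -/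

/-- Gibbs' inequality for unnormalized measures, termwise from `1 - 1/x ≤ log x`. -/
theorem sum_mul_logb_div_nonneg {ι : Type*} [Fintype ι] {b : ℝ} (hb : 1 < b) {p r : ι → ℝ}
    (hp : ∀ i, 0 ≤ p i) (hr : ∀ i, 0 ≤ r i) (hpr : ∀ i, 0 < p i → 0 < r i)
    (h : ∑ i, r i ≤ ∑ i, p i) : 0 ≤ ∑ i, p i * Real.logb b (p i / r i) := by
  have hlog : 0 < Real.log b := Real.log_pos hb
  have key : ∀ i, (p i - r i) / Real.log b ≤ p i * Real.logb b (p i / r i) := by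
    intro i
    rcases (hp i).eq_or_lt with h0 | h0
    · rw [← h0]
      simp only [zero_sub, zero_mul]
      exact div_nonpos_of_nonpos_of_nonneg (neg_nonpos.2 (hr i)) hlog.le
    · have hri := hpr i h0
      rw [Real.logb, ← mul_div_assoc]
      refine div_le_div_of_nonneg_right ?_ hlog.le
      have h1 := Real.one_sub_inv_le_log_of_pos (div_pos h0 hri)
      calc p i - r i = p i * (1 - (p i / r i)⁻¹) := by field_simp
        _ ≤ _ := mul_le_mul_of_nonneg_left h1 h0.le
  calc (0 : ℝ) ≤ (∑ i, p i - ∑ i, r i) / Real.log b := div_nonneg (sub_nonneg.2 h) hlog.le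
    _ = ∑ i, (p i - r i) / Real.log b := by
      rw [← Finset.sum_div, Finset.sum_sub_distrib]
    _ ≤ _ := Finset.sum_le_sum fun i _ => key i

theorem sum_fst_pos {Y Z : Type*} [Fintype Y] {Q : Y × Z → ℝ} (hQ : ∀ a, 0 ≤ Q a) {y : Y} {z : Z} (h : 0 < Q (y, z)) :
    0 < ∑ y', Q (y', z) :=
  lt_of_lt_of_le h (Finset.single_le_sum (f := fun y' => Q (y', z)) (fun y' _ => hQ (y', z))
    (Finset.mem_univ y))

theorem sum_snd_pos {Y Z : Type*} [Fintype Z] {Q : Y × Z → ℝ} (hQ : ∀ a, 0 ≤ Q a) {y : Y} {z : Z} (h : 0 < Q (y, z)) :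
    0 < ∑ z', Q (y, z') :=
  lt_of_lt_of_le h (Finset.single_le_sum (f := fun z' => Q (y, z')) (fun z' _ => hQ (y, z'))
    (Finset.mem_univ z))

section MutualInfo

variable {Y Z : Type*} [Fintype Y] [Fintype Z]

/-- Mutual information dominates the expected log-likelihood ratio of any reverse channel. -/
theorem le_mutualInfo_of_channel {b : ℝ} (hb : 1 < b) {Q : Y × Z → ℝ} (hQ : ∀ a, 0 ≤ Q a)
    {R : Y → Z → ℝ} (hR : ∀ y z, 0 ≤ R y z) (hR1 : ∀ z, ∑ y, R y z ≤ 1)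
    (hpos : ∀ y z, 0 < Q (y, z) → 0 < R y z) :
    ∑ y, ∑ z, Q (y, z) * Real.logb b (R y z / ∑ z', Q (y, z')) ≤ mutualInfo b Q := by
  -- The gap between the two sides is the divergence of `Q` from the measure with the same `Z`
  -- marginal and reverse channel `R`.
  have h := sum_mul_logb_div_nonneg hb (p := Q) (r := fun a => (∑ y', Q (y', a.2)) * R a.1 a.2) hQ
    (fun a => mul_nonneg (Finset.sum_nonneg fun _ _ => hQ _) (hR _ _))
    (fun a ha => mul_pos (sum_fst_pos hQ ha) (hpos _ _ ha)) (by
      rw [Fintype.sum_prod_type_right, Fintype.sum_prod_type_right]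
      refine Finset.sum_le_sum fun z _ => ?_
      simp only
      rw [← Finset.mul_sum]
      exact mul_le_of_le_one_right (Finset.sum_nonneg fun _ _ => hQ _) (hR1 z))
  rw [← sub_nonneg]
  refine h.trans_eq ?_
  rw [mutualInfo, Fintype.sum_prod_type, ← Finset.sum_sub_distrib]
  refine Finset.sum_congr rfl fun y _ => ?_
  rw [← Finset.sum_sub_distrib]
  refine Finset.sum_congr rfl fun z _ => ?_
  rcases (hQ (y, z)).eq_or_lt with h0 | h0
  · simp [← h0]
  · have h1 := sum_fst_pos hQ h0
    have h2 := sum_snd_pos hQ h0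
    have h3 := hpos y z h0
    rw [← mul_sub, ← Real.logb_div (by positivity) (by positivity)]
    congr 2
    field_simp

/-- The reverse channel that ignores `z` and returns the `Y` marginal has log-likelihood ratio zero.
-/
theorem mutualInfo_nonneg {b : ℝ} (hb : 1 < b) {Q : Y × Z → ℝ} (hQ : ∀ a, 0 ≤ Q a)
    (hQ1 : ∑ a, Q a = 1) : 0 ≤ mutualInfo b Q := by
  refine le_trans (le_of_eq ?_) (le_mutualInfo_of_channel hb hQ
    (R := fun y _ => ∑ z', Q (y, z')) (fun y _ => Finset.sum_nonneg fun _ _ => hQ _)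
    (fun z => by rw [← hQ1, Fintype.sum_prod_type]) (fun y z h => sum_snd_pos hQ h))
  symm
  refine Finset.sum_eq_zero fun y _ => Finset.sum_eq_zero fun z _ => ?_
  by_cases h : ∑ z', Q (y, z') = 0
  · simp [h]
  · rw [div_self h, Real.logb_one, mul_zero]

/-- The entropy form `H(Y) + H(Z) - H(Y,Z)`; it is continuous up to the boundary because `negMulLog`
is continuous at `0`. -/
theorem mutualInfo_eq_negMulLog (b : ℝ) {Q : Y × Z → ℝ} (hQ : ∀ a, 0 ≤ Q a) :
    mutualInfo b Q = ((∑ y, Real.negMulLog (∑ z, Q (y, z))) + (∑ z, Real.negMulLog (∑ y, Q (y, z)))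
      - ∑ y, ∑ z, Real.negMulLog (Q (y, z))) / Real.log b := by
  have h1 : ∑ y, Real.negMulLog (∑ z, Q (y, z))
      = ∑ y, ∑ z, -(Q (y, z) * Real.log (∑ z', Q (y, z'))) := by
    refine Finset.sum_congr rfl fun y _ => ?_
    rw [Real.negMulLog, Finset.sum_neg_distrib, ← Finset.sum_mul, neg_mul]
  have h2 : ∑ z, Real.negMulLog (∑ y, Q (y, z))
      = ∑ y, ∑ z, -(Q (y, z) * Real.log (∑ y', Q (y', z))) := by
    rw [Finset.sum_comm]
    refine Finset.sum_congr rfl fun y _ => ?_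
    rw [Real.negMulLog, Finset.sum_neg_distrib, ← Finset.sum_mul, neg_mul]
  rw [h1, h2, mutualInfo, ← Finset.sum_add_distrib, ← Finset.sum_sub_distrib, Finset.sum_div]
  refine Finset.sum_congr rfl fun y _ => ?_
  rw [← Finset.sum_add_distrib, ← Finset.sum_sub_distrib, Finset.sum_div]
  refine Finset.sum_congr rfl fun z _ => ?_
  rcases (hQ (y, z)).eq_or_lt with h0 | h0
  · simp [← h0]
  · have h1 := sum_fst_pos hQ h0
    have h2 := sum_snd_pos hQ h0
    rw [Real.logb, Real.log_div h0.ne' (by positivity), Real.log_mul h2.ne' h1.ne', Real.negMulLog]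
    ring

theorem continuousOn_mutualInfo (b : ℝ) :
    ContinuousOn (fun Q : Y × Z → ℝ => mutualInfo b Q) {Q | ∀ a, 0 ≤ Q a} := by
  refine ContinuousOn.congr (Continuous.continuousOn ?_) fun Q hQ => mutualInfo_eq_negMulLog b hQ
  fun_prop

/-- The perspective `|q| I(q / |q|)` of mutual information, for a measure `q` of total mass
`|q|`. -/
noncomputable def perspectiveInfo (b : ℝ) (q : Y × Z → ℝ) : ℝ :=
  mutualInfo b q + (∑ a, q a) * Real.logb b (∑ a, q a)

theorem continuousOn_perspectiveInfo (b : ℝ) :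
    ContinuousOn (fun q : Y × Z → ℝ => perspectiveInfo b q) {q | ∀ a, 0 ≤ q a} := by
  refine (continuousOn_mutualInfo b).add (Continuous.continuousOn ?_)
  have h : Continuous fun q : Y × Z → ℝ => -Real.negMulLog (∑ a, q a) / Real.log b := by fun_prop
  refine h.congr fun q => ?_
  rw [Real.negMulLog, Real.logb]
  ring

theorem perspectiveInfo_eq_sum (b : ℝ) {q : Y × Z → ℝ} (hq : ∀ a, 0 ≤ q a) :
    perspectiveInfo b q = ∑ y, ∑ z, q (y, z) *
      Real.logb b (q (y, z) * (∑ a, q a) / ((∑ z', q (y, z')) * ∑ y', q (y', z))) := by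
  rw [perspectiveInfo, mutualInfo, Finset.sum_mul, Fintype.sum_prod_type, ← Finset.sum_add_distrib]
  refine Finset.sum_congr rfl fun y _ => ?_
  rw [← Finset.sum_add_distrib]
  refine Finset.sum_congr rfl fun z _ => ?_
  rcases (hq (y, z)).eq_or_lt with h0 | h0
  · simp [← h0]
  · have h1 := sum_fst_pos hq h0
    have h2 := sum_snd_pos hq h0
    have h3 : 0 < ∑ a, q a := h0.trans_le
      (Finset.single_le_sum (f := q) (fun a _ => hq a) (Finset.mem_univ (y, z)))
    rw [← mul_add, ← Real.logb_mul (by positivity) (by positivity)]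
    congr 2
    ring

theorem perspectiveInfo_eq_mul (b : ℝ) {q : Y × Z → ℝ} (hq : ∀ a, 0 ≤ q a) (h : 0 < ∑ a, q a) :
    perspectiveInfo b q = (∑ a, q a) * mutualInfo b (fun a => q a / ∑ a', q a') := by
  rw [perspectiveInfo_eq_sum b hq, mutualInfo, Finset.mul_sum]
  refine Finset.sum_congr rfl fun y _ => ?_
  rw [Finset.mul_sum]
  refine Finset.sum_congr rfl fun z _ => ?_
  rw [← Finset.sum_div, ← Finset.sum_div, ← mul_assoc, mul_div_cancel₀ _ h.ne']
  rcases (hq (y, z)).eq_or_lt with h0 | h0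
  · simp [← h0]
  · have h1 := sum_fst_pos hq h0
    have h2 := sum_snd_pos hq h0
    congr 2
    field_simp

/-- Replacing the first marginal of the measure `q` by a reference law `p` in the information
density can only increase its integral. -/
theorem perspectiveInfo_le {b : ℝ} (hb : 1 < b) {q : Y × Z → ℝ} (hq : ∀ a, 0 ≤ q a)
    {p : Y → ℝ} (hp : ∀ y, 0 ≤ p y) (hp1 : ∑ y, p y ≤ 1) (hpos : ∀ y z, 0 < q (y, z) → 0 < p y) :
    perspectiveInfo b q ≤
      ∑ y, ∑ z, q (y, z) * Real.logb b ((q (y, z) / ∑ y', q (y', z)) / p y) := by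
  have hS : 0 ≤ ∑ a, q a := Finset.sum_nonneg fun a _ => hq a
  have hposY : ∀ y, 0 < ∑ z, q (y, z) → 0 < p y := by
    intro y hy
    obtain ⟨z, -, hz⟩ := Finset.exists_lt_of_sum_lt (s := Finset.univ) (f := fun _ : Z => (0 : ℝ))
      (g := fun z => q (y, z)) (by simpa using hy)
    exact hpos y z hz
  -- The gap is the divergence of the first marginal of `q` from `|q| p`.
  have h := sum_mul_logb_div_nonneg hb (p := fun y => ∑ z, q (y, z))
    (r := fun y => (∑ a, q a) * p y) (fun y => Finset.sum_nonneg fun _ _ => hq _)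
    (fun y => mul_nonneg hS (hp y))
    (fun y hy => mul_pos (hy.trans_le (by
      rw [Fintype.sum_prod_type]
      exact Finset.single_le_sum (f := fun y => ∑ z, q (y, z))
        (fun y _ => Finset.sum_nonneg fun z _ => hq (y, z)) (Finset.mem_univ y))) (hposY y hy))
    (by
      rw [← Finset.mul_sum, ← Fintype.sum_prod_type (f := q)]
      exact mul_le_of_le_one_right hS hp1)
  rw [← sub_nonneg]
  refine h.trans_eq ?_
  rw [perspectiveInfo_eq_sum b hq, ← Finset.sum_sub_distrib]
  refine Finset.sum_congr rfl fun y _ => ?_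
  rw [Finset.sum_mul, ← Finset.sum_sub_distrib]
  refine Finset.sum_congr rfl fun z _ => ?_
  rcases (hq (y, z)).eq_or_lt with h0 | h0
  · simp [← h0]
  · have h1 := sum_fst_pos hq h0
    have h2 := sum_snd_pos hq h0
    have h3 := hpos y z h0
    have h4 : 0 < ∑ a, q a := h0.trans_le
      (Finset.single_le_sum (f := q) (fun a _ => hq a) (Finset.mem_univ (y, z)))
    rw [← mul_sub, ← Real.logb_div (by positivity) (by positivity)]
    congr 2
    field_simp

end MutualInfo

/-! ### Moments and information of i.i.d. sequences -/

section Iid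

variable {A : Type*} [Fintype A]

theorem sum_pi_prod {n : ℕ} (f : Fin n → A → ℝ) :
    ∑ a : Fin n → A, ∏ i, f i (a i) = ∏ i, ∑ x, f i x := by
  classical
  rw [Finset.prod_univ_sum, Fintype.piFinset_univ]

theorem sum_pi_prod_mul_apply {p : A → ℝ} (hp : ∑ x, p x = 1) (F : A → ℝ) {n : ℕ} (j : Fin n) :
    ∑ a : Fin n → A, (∏ i, p (a i)) * F (a j) = ∑ x, p x * F x := by
  have h := sum_pi_prod (fun (i : Fin n) x => p x * (if i = j then F x else 1))
  simp only [Finset.prod_mul_distrib, Finset.prod_ite_eq', Finset.mem_univ, if_true] at h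
  rw [h, Finset.prod_eq_single j]
  · simp
  · intro i _ hi
    simp [hi, hp]
  · simp

theorem sum_pi_prod_mul_apply_mul_apply {p : A → ℝ} {F : A → ℝ}
    (hF : ∑ x, p x * F x = 0) {n : ℕ} {j k : Fin n} (hjk : j ≠ k) :
    ∑ a : Fin n → A, (∏ i, p (a i)) * (F (a j) * F (a k)) = 0 := by
  have h := sum_pi_prod (fun (i : Fin n) x =>
    p x * ((if i = j then F x else 1) * (if i = k then F x else 1)))
  simp only [Finset.prod_mul_distrib, Finset.prod_ite_eq', Finset.mem_univ, if_true] at h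
  rw [h]
  refine Finset.prod_eq_zero (Finset.mem_univ j) ?_
  simpa [hjk] using hF

/-- After expanding the square, the off-diagonal terms vanish by independence and centring. This
second moment drives both the marginal estimate of the converse and Chebyshev's inequality in the
achievability. -/
theorem sum_pi_prod_mul_sum_sq {p : A → ℝ} (hp : ∑ x, p x = 1) {F : A → ℝ}
    (hF : ∑ x, p x * F x = 0) (n : ℕ) :
    ∑ a : Fin n → A, (∏ i, p (a i)) * (∑ i, F (a i)) ^ 2 = n * ∑ x, p x * F x ^ 2 := by
  have h : ∀ a : Fin n → A, (∏ i, p (a i)) * (∑ i, F (a i)) ^ 2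
      = ∑ j, ∑ k, (∏ i, p (a i)) * (F (a j) * F (a k)) := by
    intro a
    rw [sq, Finset.sum_mul_sum, Finset.mul_sum]
    exact Finset.sum_congr rfl fun j _ => Finset.mul_sum _ _ _
  simp_rw [h]
  rw [Finset.sum_comm]
  have h2 : ∀ j : Fin n, ∑ a : Fin n → A, ∑ k, (∏ i, p (a i)) * (F (a j) * F (a k))
      = ∑ x, p x * F x ^ 2 := by
    intro j
    rw [Finset.sum_comm, Finset.sum_eq_single j]
    · simp_rw [← sq]
      exact sum_pi_prod_mul_apply hp (fun x => F x ^ 2) j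
    · intro k _ hk
      exact sum_pi_prod_mul_apply_mul_apply hF hk.symm
    · simp
  simp [h2]

end Iid

theorem sum_iidLaw_mul {Y Z : Type*} [Fintype Y] [Fintype Z] (Q : Y × Z → ℝ) (n : ℕ)
    (G : (Fin n → Y) → (Fin n → Z) → ℝ) :
    ∑ y, ∑ z, iidLaw Q n (y, z) * G y z =
      ∑ a : Fin n → Y × Z, (∏ i, Q (a i)) * G (fun i => (a i).1) (fun i => (a i).2) := by
  rw [← Fintype.sum_prod_type' (f := fun y z => iidLaw Q n (y, z) * G y z)]
  exact (Equiv.sum_comp (Equiv.arrowProdEquivProdArrow (Fin n) (fun _ => Y) (fun _ => Z))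
    (fun a => iidLaw Q n (a.1, a.2) * G a.1 a.2)).symm

theorem iidLaw_mem_stdSimplex {Y Z : Type*} [Fintype Y] [Fintype Z] {Q : Y × Z → ℝ}
    (hQ : Q ∈ stdSimplex ℝ (Y × Z)) (n : ℕ) :
    iidLaw Q n ∈ stdSimplex ℝ ((Fin n → Y) × (Fin n → Z)) := by
  refine ⟨fun a => Finset.prod_nonneg fun i _ => hQ.1 _, ?_⟩
  rw [Fintype.sum_prod_type]
  have h := sum_iidLaw_mul Q n (fun _ _ => 1)
  simp only [mul_one] at h
  rw [h, sum_pi_prod (fun _ => Q)]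
  simp [hQ.2]

theorem sum_snd_iidLaw {Y Z : Type*} [Fintype Z] (Q : Y × Z → ℝ) (n : ℕ)
    (y : Fin n → Y) : ∑ z, iidLaw Q n (y, z) = ∏ i, ∑ z, Q (y i, z) :=
  sum_pi_prod (fun i z => Q (y i, z))

theorem sum_fst_iidLaw {Y Z : Type*} [Fintype Y] (Q : Y × Z → ℝ) (n : ℕ)
    (z : Fin n → Z) : ∑ y, iidLaw Q n (y, z) = ∏ i, ∑ y, Q (y, z i) :=
  sum_pi_prod (fun i y => Q (y, z i))

/-- On the support, the information density of the product law is the sum of the letterwise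
densities, each with mean `mutualInfo b Q`. -/
theorem mutualInfo_iidLaw {Y Z : Type*} [Fintype Y] [Fintype Z] (b : ℝ) {Q : Y × Z → ℝ}
    (hQ : Q ∈ stdSimplex ℝ (Y × Z)) (n : ℕ) :
    mutualInfo b (iidLaw Q n) = n * mutualInfo b Q := by
  have h : mutualInfo b (iidLaw Q n) = ∑ y, ∑ z, iidLaw Q n (y, z) *
      ∑ i, Real.logb b (Q (y i, z i) / ((∑ z', Q (y i, z')) * ∑ y', Q (y', z i))) := by
    refine Finset.sum_congr rfl fun y _ => Finset.sum_congr rfl fun z _ => ?_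
    by_cases h0 : iidLaw Q n (y, z) = 0
    · simp [h0]
    · rw [sum_snd_iidLaw, sum_fst_iidLaw, ← Finset.prod_mul_distrib]
      have h1 : iidLaw Q n (y, z) = ∏ i, Q (y i, z i) := rfl
      rw [h1] at h0 ⊢
      rw [← Finset.prod_div_distrib, Real.logb_prod]
      intro i hi
      have h2 : 0 < Q (y i, z i) := (hQ.1 _).lt_of_ne' (Finset.prod_ne_zero_iff.1 h0 i hi)
      have h3 := sum_fst_pos hQ.1 h2
      have h4 := sum_snd_pos hQ.1 h2
      positivity
  rw [h, sum_iidLaw_mul, Finset.sum_congr rfl fun a _ => Finset.mul_sum _ _ _]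
  rw [Finset.sum_comm]
  have h2 : ∀ j : Fin n, ∑ a : Fin n → Y × Z, (∏ i, Q (a i)) * Real.logb b
      (Q ((a j).1, (a j).2) / ((∑ z', Q ((a j).1, z')) * ∑ y', Q (y', (a j).2)))
      = mutualInfo b Q := by
    intro j
    rw [sum_pi_prod_mul_apply hQ.2 (fun c => Real.logb b
      (Q (c.1, c.2) / ((∑ z', Q (c.1, z')) * ∑ y', Q (y', c.2)))) j, Fintype.sum_prod_type]
    rfl
  simp only [h2, Finset.sum_const, Finset.card_univ, Fintype.card_fin, nsmul_eq_mul]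

/-- Mutual information is convex in the channel. -/
theorem mutualInfo_sum_le {Y Z ι : Type*} [Fintype Y] [Fintype Z] [Fintype ι] {b : ℝ} (hb : 1 < b)
    {w : ι → ℝ} (hw : w ∈ stdSimplex ℝ ι) {Q : ι → Y × Z → ℝ} (hQ : ∀ j a, 0 ≤ Q j a)
    {p : Y → ℝ} (hp : ∀ j y, ∑ z, Q j (y, z) = p y) :
    mutualInfo b (fun a => ∑ j, w j * Q j a) ≤ ∑ j, w j * mutualInfo b (Q j) := by
  set M : Y × Z → ℝ := fun a => ∑ j, w j * Q j a with hM
  have hM0 : ∀ a, 0 ≤ M a := fun a => Finset.sum_nonneg fun j _ => mul_nonneg (hw.1 j) (hQ j a)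
  have hMY : ∀ y, ∑ z, M (y, z) = p y := by
    intro y
    simp only [hM]
    rw [Finset.sum_comm]
    simp_rw [← Finset.mul_sum, hp]
    rw [← Finset.sum_mul, hw.2, one_mul]
  have hpos : ∀ j a, 0 < w j → 0 < Q j a → 0 < M a := fun j a h1 h2 =>
    (mul_pos h1 h2).trans_le (Finset.single_le_sum (f := fun j => w j * Q j a)
      (fun j _ => mul_nonneg (hw.1 j) (hQ j a)) (Finset.mem_univ j))
  -- Every `Q j` is tested against the reverse channel of the mixture `M`. As the first marginal `p`
  -- is common, the log ratio does not depend on `j`, and the weighted sum is exactly the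
  -- information of `M`.
  have hj : ∀ j, w j * (∑ y, ∑ z, Q j (y, z) *
      Real.logb b ((M (y, z) / ∑ y', M (y', z)) / p y)) ≤ w j * mutualInfo b (Q j) := by
    intro j
    rcases (hw.1 j).eq_or_lt with h0 | h0
    · simp [← h0]
    · refine mul_le_mul_of_nonneg_left ?_ h0.le
      have h := le_mutualInfo_of_channel hb (hQ j) (R := fun y z => M (y, z) / ∑ y', M (y', z))
        (fun y z => div_nonneg (hM0 _) (Finset.sum_nonneg fun _ _ => hM0 _))
        (fun z => by rw [← Finset.sum_div]; exact div_self_le_one _)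
        (fun y z h1 => div_pos (hpos j _ h0 h1) (sum_fst_pos hM0 (hpos j _ h0 h1)))
      simpa only [hp] using h
  have hlin : ∀ G : Y → Z → ℝ, ∑ j, w j * (∑ y, ∑ z, Q j (y, z) * G y z)
      = ∑ y, ∑ z, M (y, z) * G y z := by
    intro G
    simp only [hM, Finset.mul_sum, Finset.sum_mul]
    rw [Finset.sum_comm]
    refine Finset.sum_congr rfl fun y _ => ?_
    rw [Finset.sum_comm]
    exact Finset.sum_congr rfl fun z _ => Finset.sum_congr rfl fun j _ => (mul_assoc _ _ _).symm
  refine le_trans (le_of_eq ?_) (Finset.sum_le_sum fun j _ => hj j)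
  rw [hlin fun y z => Real.logb b ((M (y, z) / ∑ y', M (y', z)) / p y), mutualInfo]
  refine Finset.sum_congr rfl fun y _ => Finset.sum_congr rfl fun z _ => ?_
  rw [hMY y, div_div, mul_comm (p y)]

/-! ### Mixtures and memoryless extensions of mechanisms -/

section Mechanism

variable {X Y Z : Type*}

/-- The law of `(Y,Z)` induced by a mechanism. -/
def outputLaw [Fintype X] (P : X × Y → ℝ) (W : X → Y → Z → ℝ) : Y × Z → ℝ :=
  fun yz => ∑ x, P (x, yz.1) * W x yz.1 yz.2

theorem leakage_eq [Fintype X] [Fintype Y] [Fintype Z] (b : ℝ) (P : X × Y → ℝ) (W : X → Y → Z → ℝ) :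
    leakage b P W = mutualInfo b (outputLaw P W) := rfl

theorem sum_outputLaw [Fintype X] [Fintype Z] (P : X × Y → ℝ) {W : X → Y → Z → ℝ} (hW : IsMechanism W) (y : Y) :
    ∑ z, outputLaw P W (y, z) = ∑ x, P (x, y) := by
  simp only [outputLaw]
  rw [Finset.sum_comm]
  simp_rw [← Finset.mul_sum, (hW _ _).2, mul_one]

theorem outputLaw_mem_stdSimplex [Fintype X] [Fintype Y] [Fintype Z] {P : X × Y → ℝ} (hP : P ∈ stdSimplex ℝ (X × Y))
    {W : X → Y → Z → ℝ} (hW : IsMechanism W) : outputLaw P W ∈ stdSimplex ℝ (Y × Z) := by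
  refine ⟨fun a => Finset.sum_nonneg fun x _ => mul_nonneg (hP.1 _) ((hW _ _).1 _), ?_⟩
  rw [Fintype.sum_prod_type]
  simp_rw [sum_outputLaw P hW]
  rw [← Fintype.sum_prod_type_right, hP.2]

theorem leakage_nonneg [Fintype X] [Fintype Y] [Fintype Z] {b : ℝ} (hb : 1 < b) {P : X × Y → ℝ} (hP : P ∈ stdSimplex ℝ (X × Y))
    {W : X → Y → Z → ℝ} (hW : IsMechanism W) : 0 ≤ leakage b P W :=
  mutualInfo_nonneg hb (outputLaw_mem_stdSimplex hP hW).1 (outputLaw_mem_stdSimplex hP hW).2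

/-- The mixture of a finite family of mechanisms. -/
def mixture {ι : Type*} [Fintype ι] (w : ι → ℝ) (W : ι → X → Y → Z → ℝ) : X → Y → Z → ℝ :=
  fun x y z => ∑ j, w j * W j x y z

variable {ι : Type*} [Fintype ι] {w : ι → ℝ} {W : ι → X → Y → Z → ℝ}

theorem isMechanism_mixture [Fintype Z] (hw : w ∈ stdSimplex ℝ ι) (hW : ∀ j, IsMechanism (W j)) :
    IsMechanism (mixture w W) := by
  intro x y
  refine ⟨fun z => Finset.sum_nonneg fun j _ => mul_nonneg (hw.1 j) ((hW j x y).1 z), ?_⟩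
  simp only [mixture]
  rw [Finset.sum_comm]
  simp_rw [← Finset.mul_sum, (hW _ _ _).2, mul_one]
  exact hw.2

theorem expect_mixture [Fintype X] [Fintype Y] [Fintype Z] (P : X × Y → ℝ) (w : ι → ℝ) (W : ι → X → Y → Z → ℝ) (f : X → Z → ℝ) :
    expect P (mixture w W) f = ∑ j, w j * expect P (W j) f := by
  simp only [expect, mixture, Finset.mul_sum, Finset.sum_mul]
  rw [Finset.sum_comm]
  rw [Finset.sum_comm]
  symm
  rw [Finset.sum_comm]
  refine Finset.sum_congr rfl fun x _ => ?_
  rw [Finset.sum_comm]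
  refine Finset.sum_congr rfl fun y _ => ?_
  rw [Finset.sum_comm]
  refine Finset.sum_congr rfl fun z _ => Finset.sum_congr rfl fun j _ => ?_
  ring

theorem leakage_mixture_le [Fintype X] [Fintype Y] [Fintype Z] {b : ℝ} (hb : 1 < b) {P : X × Y → ℝ} (hP : ∀ a, 0 ≤ P a)
    (hw : w ∈ stdSimplex ℝ ι) (hW : ∀ j, IsMechanism (W j)) :
    leakage b P (mixture w W) ≤ ∑ j, w j * leakage b P (W j) := by
  have h : outputLaw P (mixture w W) = fun a => ∑ j, w j * outputLaw P (W j) a := by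
    funext a
    simp only [outputLaw, mixture, Finset.mul_sum]
    rw [Finset.sum_comm]
    refine Finset.sum_congr rfl fun j _ => Finset.sum_congr rfl fun x _ => ?_
    ring
  rw [leakage_eq, h]
  exact mutualInfo_sum_le hb hw
    (fun j a => Finset.sum_nonneg fun x _ => mul_nonneg (hP _) ((hW j _ _).1 _))
    (fun j y => sum_outputLaw P (hW j) y)

/-- The memoryless extension of a single letter mechanism. -/
def memoryless (W : X → Y → Z → ℝ) (n : ℕ) : (Fin n → X) → (Fin n → Y) → (Fin n → Z) → ℝ :=
  fun x y z => ∏ i, W (x i) (y i) (z i)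

theorem isMechanism_memoryless [Fintype Z] {W : X → Y → Z → ℝ} (hW : IsMechanism W) (n : ℕ) :
    IsMechanism (memoryless W n) := by
  intro x y
  refine ⟨fun z => Finset.prod_nonneg fun i _ => (hW _ _).1 _, ?_⟩
  simp only [memoryless]
  rw [sum_pi_prod (fun i z => W (x i) (y i) z)]
  simp [(hW _ _).2]

theorem leakage_memoryless [Fintype X] [Fintype Y] [Fintype Z] (b : ℝ) {P : X × Y → ℝ} (hP : P ∈ stdSimplex ℝ (X × Y))
    {W : X → Y → Z → ℝ} (hW : IsMechanism W) (n : ℕ) :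
    leakage b (iidLaw P n) (memoryless W n) = n * leakage b P W := by
  have h : outputLaw (iidLaw P n) (memoryless W n) = iidLaw (outputLaw P W) n := by
    funext a
    simp only [outputLaw, iidLaw, memoryless, ← Finset.prod_mul_distrib]
    exact sum_pi_prod (fun i x => P (x, a.1 i) * W x (a.1 i) (a.2 i))
  rw [leakage_eq, h, mutualInfo_iidLaw b (outputLaw_mem_stdSimplex hP hW), leakage_eq]

theorem expect_iidLaw_memoryless [Fintype X] [Fintype Y] [Fintype Z] (P : X × Y → ℝ) (W : X → Y → Z → ℝ) (n : ℕ)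
    (f : (Fin n → X) → (Fin n → Z) → ℝ) :
    expect (iidLaw P n) (memoryless W n) f = ∑ a : Fin n → X × Y × Z,
      (∏ i, P ((a i).1, (a i).2.1) * W (a i).1 (a i).2.1 (a i).2.2) *
        f (fun i => (a i).1) (fun i => (a i).2.2) := by
  have e1 := Equiv.sum_comp (Equiv.arrowProdEquivProdArrow (Fin n) (fun _ => X) (fun _ => Y × Z))
    (fun a => iidLaw P n (a.1, fun i => (a.2 i).1) *
      memoryless W n a.1 (fun i => (a.2 i).1) (fun i => (a.2 i).2) * f a.1 (fun i => (a.2 i).2))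
  simp only [Finset.prod_mul_distrib]
  refine Eq.trans ?_ e1.symm
  rw [expect, Fintype.sum_prod_type]
  refine Finset.sum_congr rfl fun x _ => ?_
  have e2 := Equiv.sum_comp (Equiv.arrowProdEquivProdArrow (Fin n) (fun _ => Y) (fun _ => Z))
    (fun a => iidLaw P n (x, a.1) * memoryless W n x a.1 a.2 * f x a.2)
  refine Eq.trans ?_ e2.symm
  rw [Fintype.sum_prod_type]

end Mechanism

/-! ### The single letter leakage: stability, convexity, continuity -/

/-- The continuous function `max ψ (φ + ε)` is positive on `K`, so it has a positive minimum; half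
of that minimum serves as `δ`. Here `ψ` plays the role of a total constraint violation. -/
theorem IsCompact.exists_pos_forall_le_imp_neg_le {E : Type*} [TopologicalSpace E] {K : Set E}
    (hK : IsCompact K) {φ ψ : E → ℝ} (hφ : ContinuousOn φ K) (hψ : ContinuousOn ψ K)
    (hψ0 : ∀ q ∈ K, 0 ≤ ψ q) (h : ∀ q ∈ K, ψ q = 0 → 0 ≤ φ q) {ε : ℝ} (hε : 0 < ε) :
    ∃ δ > 0, ∀ q ∈ K, ψ q ≤ δ → -ε ≤ φ q := by
  have hmax : ContinuousOn (fun q => max (ψ q) (φ q + ε)) K :=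
    hψ.sup (hφ.add continuousOn_const)
  rcases K.eq_empty_or_nonempty with rfl | hne
  · exact ⟨1, one_pos, by simp⟩
  obtain ⟨q₀, hq₀, hmin⟩ := hK.exists_isMinOn hne hmax
  have hpos : 0 < max (ψ q₀) (φ q₀ + ε) := by
    rcases (hψ0 q₀ hq₀).eq_or_lt with h0 | h0
    · exact lt_max_of_lt_right (by linarith [h q₀ hq₀ h0.symm])
    · exact lt_max_of_lt_left h0
  refine ⟨max (ψ q₀) (φ q₀ + ε) / 2, half_pos hpos, fun q hq hle => ?_⟩
  have h1 : max (ψ q₀) (φ q₀ + ε) ≤ max (ψ q) (φ q + ε) := hmin hq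
  rcases le_max_iff.1 h1 with h2 | h2 <;> linarith

section SingleLetter

variable {X Y Z : Type*} [Fintype X] [Fintype Y] [Fintype Z] {b : ℝ} {P : X × Y → ℝ}
  {d : X → Z → ℝ}

theorem singleLetterLeakage_nonneg (hb : 1 < b) (hP : P ∈ stdSimplex ℝ (X × Y)) (D : ℝ) :
    0 ≤ singleLetterLeakage b P d D :=
  le_iInf₂ fun _ hW => EReal.coe_nonneg.2 (leakage_nonneg hb hP hW.1)

theorem singleLetterLeakage_le {W : X → Y → Z → ℝ} (hW : IsMechanism W) {D : ℝ}
    (hD : expect P W d ≤ D) : singleLetterLeakage b P d D ≤ (leakage b P W : ℝ) :=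
  iInf₂_le W ⟨hW, hD⟩

theorem coe_toReal_singleLetterLeakage (hb : 1 < b) (hP : P ∈ stdSimplex ℝ (X × Y)) {D : ℝ}
    (hD : singleLetterLeakage b P d D ≠ ⊤) :
    ((singleLetterLeakage b P d D).toReal : EReal) = singleLetterLeakage b P d D :=
  EReal.coe_toReal hD
    (ne_of_gt ((EReal.bot_lt_zero).trans_le (singleLetterLeakage_nonneg hb hP D)))

theorem toReal_singleLetterLeakage_nonneg (hb : 1 < b) (hP : P ∈ stdSimplex ℝ (X × Y)) (D : ℝ) :
    0 ≤ (singleLetterLeakage b P d D).toReal :=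
  EReal.toReal_nonneg (singleLetterLeakage_nonneg hb hP D)

theorem toReal_singleLetterLeakage_le (hb : 1 < b) (hP : P ∈ stdSimplex ℝ (X × Y))
    {W : X → Y → Z → ℝ} (hW : IsMechanism W) {D : ℝ} (hD : expect P W d ≤ D) :
    (singleLetterLeakage b P d D).toReal ≤ leakage b P W := by
  have h := singleLetterLeakage_le (b := b) hW hD
  rw [← coe_toReal_singleLetterLeakage hb hP (h.trans_lt (EReal.coe_lt_top _)).ne] at h
  exact EReal.coe_le_coe_iff.1 h

/-- Near-minimizers suffice throughout, so attainment of the infimum is never needed. -/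
theorem exists_leakage_le_toReal_add (hb : 1 < b) (hP : P ∈ stdSimplex ℝ (X × Y)) {D : ℝ}
    (hD : singleLetterLeakage b P d D ≠ ⊤) {ε : ℝ} (hε : 0 < ε) :
    ∃ W : X → Y → Z → ℝ, IsMechanism W ∧ expect P W d ≤ D ∧
      leakage b P W ≤ (singleLetterLeakage b P d D).toReal + ε := by
  have h : singleLetterLeakage b P d D
      < (((singleLetterLeakage b P d D).toReal + ε : ℝ) : EReal) := by
    nth_rewrite 1 [← coe_toReal_singleLetterLeakage hb hP hD]
    exact EReal.coe_lt_coe_iff.2 (by linarith)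
  nth_rewrite 1 [singleLetterLeakage] at h
  simp only [iInf_lt_iff] at h
  obtain ⟨W, hW, hlt⟩ := h
  exact ⟨W, hW.1, hW.2, (EReal.coe_lt_coe_iff.1 hlt).le⟩

/-- Finiteness at the smaller level cannot be dropped, because `toReal` sends `⊤` to `0`. -/
theorem toReal_singleLetterLeakage_anti (hb : 1 < b) (hP : P ∈ stdSimplex ℝ (X × Y)) {D D' : ℝ}
    (hD : singleLetterLeakage b P d D ≠ ⊤) (h : D ≤ D') :
    (singleLetterLeakage b P d D').toReal ≤ (singleLetterLeakage b P d D).toReal := by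
  refine le_of_forall_pos_le_add fun ε hε => ?_
  obtain ⟨W, hW, hWD, hle⟩ := exists_leakage_le_toReal_add hb hP hD hε
  exact (toReal_singleLetterLeakage_le hb hP hW (hWD.trans h)).trans hle

theorem exists_leakage_le_convex_comb (hb : 1 < b) (hP : P ∈ stdSimplex ℝ (X × Y)) {D₀ D₁ : ℝ}
    (h₀ : singleLetterLeakage b P d D₀ ≠ ⊤) (h₁ : singleLetterLeakage b P d D₁ ≠ ⊤) {s : ℝ}
    (hs : s ∈ Icc (0 : ℝ) 1) {ε : ℝ} (hε : 0 < ε) :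
    ∃ W : X → Y → Z → ℝ, IsMechanism W ∧ expect P W d ≤ s * D₀ + (1 - s) * D₁ ∧
      leakage b P W ≤ s * (singleLetterLeakage b P d D₀).toReal
        + (1 - s) * (singleLetterLeakage b P d D₁).toReal + ε := by
  obtain ⟨W₀, hW₀, hd₀, hl₀⟩ := exists_leakage_le_toReal_add hb hP h₀ hε
  obtain ⟨W₁, hW₁, hd₁, hl₁⟩ := exists_leakage_le_toReal_add hb hP h₁ hε
  have hs0 := hs.1
  have hs1 : 0 ≤ 1 - s := sub_nonneg.2 hs.2
  have hw : ![s, 1 - s] ∈ stdSimplex ℝ (Fin 2) :=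
    ⟨fun i => by fin_cases i <;> simp [hs.1, hs.2], by simp⟩
  have hW : ∀ j, IsMechanism (![W₀, W₁] j) := fun j => by fin_cases j <;> simpa
  refine ⟨mixture ![s, 1 - s] ![W₀, W₁], isMechanism_mixture hw hW, ?_, ?_⟩
  · rw [expect_mixture]
    simp only [Fin.sum_univ_two, Matrix.cons_val_zero, Matrix.cons_val_one]
    gcongr
  · refine (leakage_mixture_le hb hP.1 hw hW).trans ?_
    simp only [Fin.sum_univ_two, Matrix.cons_val_zero, Matrix.cons_val_one]
    have h2 := mul_le_mul_of_nonneg_left hl₀ hs0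
    have h3 := mul_le_mul_of_nonneg_left hl₁ hs1
    nlinarith

theorem expect_le_of_forall_le (hP : P ∈ stdSimplex ℝ (X × Y)) {W : X → Y → Z → ℝ}
    (hW : IsMechanism W) {C : ℝ} (hd : ∀ x z, d x z ≤ C) : expect P W d ≤ C := by
  calc expect P W d ≤ ∑ x, ∑ y, ∑ z, P (x, y) * W x y z * C :=
        Finset.sum_le_sum fun x _ => Finset.sum_le_sum fun y _ => Finset.sum_le_sum fun z _ =>
          mul_le_mul_of_nonneg_left (hd x z) (mul_nonneg (hP.1 _) ((hW x y).1 z))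
    _ = C := by
      simp_rw [← Finset.sum_mul, ← Finset.mul_sum, (hW _ _).2, mul_one]
      rw [← Fintype.sum_prod_type, hP.2, one_mul]

theorem leakage_const_eq_zero (b : ℝ) (hP : P ∈ stdSimplex ℝ (X × Y)) {r : Z → ℝ}
    (hr : r ∈ stdSimplex ℝ Z) : leakage b P (fun _ _ => r) = 0 := by
  rw [leakage_eq, mutualInfo]
  refine Finset.sum_eq_zero fun y _ => Finset.sum_eq_zero fun z _ => ?_
  have hW : IsMechanism (fun (_ : X) (_ : Y) => r) := fun _ _ => hr
  have h1 : ∀ y', outputLaw P (fun _ _ => r) (y', z) = (∑ x, P (x, y')) * r z := fun y' => by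
    simp [outputLaw, Finset.sum_mul]
  rw [sum_outputLaw P hW]
  simp_rw [h1]
  rw [← Finset.sum_mul, ← Fintype.sum_prod_type_right, hP.2, one_mul]
  by_cases h : (∑ x, P (x, y)) * r z = 0
  · rw [h, zero_mul]
  · rw [div_self h, Real.logb_one, mul_zero]

/-- At `Dmax` the distortion constraint is void, and an output independent of the input leaks
nothing. Finiteness is used only to obtain some law on `Z`, namely a row of a mechanism. -/
theorem toReal_singleLetterLeakage_eq_zero (hb : 1 < b) (hP : P ∈ stdSimplex ℝ (X × Y))
    {Dmax : ℝ} (hd : ∀ x z, d x z ≤ Dmax) (hfin : singleLetterLeakage b P d Dmax ≠ ⊤) :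
    (singleLetterLeakage b P d Dmax).toReal = 0 := by
  refine le_antisymm ?_ (toReal_singleLetterLeakage_nonneg hb hP _)
  obtain ⟨W, hW, -⟩ := exists_leakage_le_toReal_add hb hP hfin one_pos
  have hne : Nonempty (X × Y) := by
    by_contra h
    rw [not_nonempty_iff] at h
    simpa using hP.2
  obtain ⟨x, y⟩ := hne.some
  have hc : IsMechanism (fun (_ : X) (_ : Y) => W x y) := fun _ _ => hW x y
  exact (toReal_singleLetterLeakage_le hb hP hc (expect_le_of_forall_le hP hc hd)).trans_eq
    (leakage_const_eq_zero b hP (hW x y))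

/-- The marginal on `Y × Z` of a measure on `X × Y × Z`. -/
def marginalYZ (q : X × Y × Z → ℝ) : Y × Z → ℝ := fun a => ∑ x, q (x, a.1, a.2)

theorem sum_marginalYZ (q : X × Y × Z → ℝ) : ∑ a, marginalYZ q a = ∑ a, q a := by
  rw [Fintype.sum_prod_type (f := q), Finset.sum_comm]
  rfl

/-- A measure whose marginal on `X × Y` is a multiple of `P` has at least the leakage of the
mechanism that it induces. -/
theorem le_perspectiveInfo_of_marginal_eq (hb : 1 < b) (hP : P ∈ stdSimplex ℝ (X × Y))
    {q : X × Y × Z → ℝ} (hq : ∀ a, 0 ≤ q a) {D : ℝ}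
    (hXY : ∀ x y, ∑ z, q (x, y, z) = (∑ a, q a) * P (x, y))
    (hd : ∑ a, q a * d a.1 a.2.2 ≤ (∑ a, q a) * D) :
    (∑ a, q a) * (singleLetterLeakage b P d D).toReal ≤ perspectiveInfo b (marginalYZ q) := by
  classical
  have hm : ∀ a, 0 ≤ marginalYZ q a := fun a => Finset.sum_nonneg fun _ _ => hq _
  rcases (Finset.sum_nonneg fun a _ => hq a : 0 ≤ ∑ a, q a).eq_or_lt with h0 | h0
  · have hz : ∀ a, q a = 0 := fun a =>
      (Finset.sum_eq_zero_iff_of_nonneg fun a _ => hq a).1 h0.symm a (Finset.mem_univ a)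
    have h1 : marginalYZ q = 0 := by
      funext a
      simp [marginalYZ, hz]
    rw [← h0, h1]
    simp [perspectiveInfo, mutualInfo]
  -- The point `a₀` supplies a default output letter for the pairs `(x, y)` that `P` does not
  -- charge.
  obtain ⟨a₀, -, -⟩ := Finset.exists_lt_of_sum_lt (s := Finset.univ) (f := fun _ => (0 : ℝ))
    (g := q) (by simpa using h0)
  set p := ∑ a, q a with hp
  set W : X → Y → Z → ℝ := fun x y z =>
    if P (x, y) = 0 then (Pi.single a₀.2.2 1 : Z → ℝ) z else q (x, y, z) / (p * P (x, y)) with hWdef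
  have hPW : ∀ x y z, P (x, y) * W x y z = q (x, y, z) / p := by
    intro x y z
    by_cases h : P (x, y) = 0
    · have h1 := hXY x y
      rw [h, mul_zero] at h1
      rw [h, (Finset.sum_eq_zero_iff_of_nonneg fun z _ => hq (x, y, z)).1 h1 z (Finset.mem_univ z)]
      simp
    · simp only [hWdef, if_neg h]
      field_simp
  have hW : IsMechanism W := by
    intro x y
    by_cases h : P (x, y) = 0
    · simp only [hWdef, if_pos h]
      exact single_mem_stdSimplex ℝ a₀.2.2
    · simp only [hWdef, if_neg h]
      refine ⟨fun z => div_nonneg (hq _) (mul_nonneg h0.le (hP.1 _)), ?_⟩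
      rw [← Finset.sum_div, hXY]
      exact div_self (mul_ne_zero h0.ne' h)
  have hexp : expect P W d ≤ D := by
    have h1 : expect P W d = (∑ a, q a * d a.1 a.2.2) / p := by
      rw [expect, Finset.sum_div, Fintype.sum_prod_type]
      refine Finset.sum_congr rfl fun x _ => ?_
      rw [Fintype.sum_prod_type]
      refine Finset.sum_congr rfl fun y _ => Finset.sum_congr rfl fun z _ => ?_
      rw [hPW]
      ring
    rw [h1, div_le_iff₀ h0]
    linarith
  have hsum : ∑ a, marginalYZ q a = p := sum_marginalYZ q
  have hout : outputLaw P W = fun a => marginalYZ q a / ∑ a', marginalYZ q a' := by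
    funext a
    rw [hsum]
    simp only [outputLaw, hPW, marginalYZ, Finset.sum_div]
  rw [perspectiveInfo_eq_mul b hm (by rwa [hsum]), ← hout, hsum]
  exact mul_le_mul_of_nonneg_left (toReal_singleLetterLeakage_le hb hP hW hexp) h0.le

/-- Approximate version of `le_perspectiveInfo_of_marginal_eq`. -/
theorem exists_forall_le_perspectiveInfo (hb : 1 < b) (hP : P ∈ stdSimplex ℝ (X × Y)) (D : ℝ)
    {ε : ℝ} (hε : 0 < ε) :
    ∃ δ > 0, ∀ q : X × Y × Z → ℝ, (∀ a, 0 ≤ q a) → ∑ a, q a ≤ 1 →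
      (∀ x y, |∑ z, q (x, y, z) - (∑ a, q a) * P (x, y)| ≤ δ) →
      ∑ a, q a * d a.1 a.2.2 ≤ (∑ a, q a) * D + δ →
      (∑ a, q a) * (singleLetterLeakage b P d D).toReal - ε ≤ perspectiveInfo b (marginalYZ q) := by
  set K : Set (X × Y × Z → ℝ) := {q | (∀ a, 0 ≤ q a) ∧ ∑ a, q a ≤ 1} with hKdef
  have hK : IsCompact K := by
    refine IsCompact.of_isClosed_subset (isCompact_univ_pi fun _ => isCompact_Icc (a := (0 : ℝ))
      (b := 1)) ?_ ?_
    · have h1 : IsClosed {q : X × Y × Z → ℝ | ∀ a, 0 ≤ q a} := by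
        simp only [ofPred_forall]
        exact isClosed_iInter fun a => isClosed_le continuous_const (continuous_apply a)
      have h2 : IsClosed {q : X × Y × Z → ℝ | ∑ a, q a ≤ 1} :=
        isClosed_le (by fun_prop) continuous_const
      exact h1.inter h2
    · exact fun q hq a _ => ⟨hq.1 a, (Finset.single_le_sum (fun a _ => hq.1 a)
        (Finset.mem_univ a)).trans hq.2⟩
  -- `ψ` is the total violation of the marginal and distortion constraints; the exact version says
  -- that `φ ≥ 0` where `ψ = 0`.
  set φ : (X × Y × Z → ℝ) → ℝ := fun q => perspectiveInfo b (marginalYZ q)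
    - (∑ a, q a) * (singleLetterLeakage b P d D).toReal with hφ
  set ψ : (X × Y × Z → ℝ) → ℝ := fun q =>
    (∑ x, ∑ y, |∑ z, q (x, y, z) - (∑ a, q a) * P (x, y)|)
      + max 0 (∑ a, q a * d a.1 a.2.2 - (∑ a, q a) * D) with hψ
  have hφc : ContinuousOn φ K := by
    refine ContinuousOn.sub ?_ (Continuous.continuousOn (by fun_prop))
    refine (continuousOn_perspectiveInfo b).comp (f := marginalYZ)
      (Continuous.continuousOn ?_) fun q hq a => Finset.sum_nonneg fun _ _ => hq.1 _
    unfold marginalYZ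
    fun_prop
  have hψc : ContinuousOn ψ K := Continuous.continuousOn (by fun_prop)
  obtain ⟨δ, hδ, hδK⟩ := hK.exists_pos_forall_le_imp_neg_le hφc hψc
    (fun q _ => by positivity) (fun q hq h => by
      have h1 : 0 ≤ ∑ x, ∑ y, |∑ z, q (x, y, z) - (∑ a, q a) * P (x, y)| := by positivity
      have h2 : 0 ≤ max 0 (∑ a, q a * d a.1 a.2.2 - (∑ a, q a) * D) := le_max_left _ _
      have h3 : ∑ x, ∑ y, |∑ z, q (x, y, z) - (∑ a, q a) * P (x, y)| = 0 := by
        simp only [hψ] at h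
        linarith
      have h4 : max 0 (∑ a, q a * d a.1 a.2.2 - (∑ a, q a) * D) = 0 := by
        simp only [hψ] at h
        linarith
      rw [hφ, sub_nonneg]
      refine le_perspectiveInfo_of_marginal_eq hb hP hq.1 (fun x y => ?_) ?_
      · rw [Finset.sum_eq_zero_iff_of_nonneg fun _ _ => by positivity] at h3
        have h5 := h3 x (Finset.mem_univ x)
        rw [Finset.sum_eq_zero_iff_of_nonneg fun _ _ => by positivity] at h5
        exact sub_eq_zero.1 (abs_eq_zero.1 (h5 y (Finset.mem_univ y)))
      · exact sub_nonpos.1 (max_eq_left_iff.1 h4)) hε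
  have hc : (0 : ℝ) < Fintype.card X * Fintype.card Y + 1 := by positivity
  -- The tolerance is shared by the `|X| |Y|` marginal constraints and the single distortion
  -- constraint.
  refine ⟨δ / (Fintype.card X * Fintype.card Y + 1), by positivity, fun q hq hq1 hXY hd => ?_⟩
  have h := hδK q ⟨hq, hq1⟩ (by
    calc ψ q ≤ (∑ _x : X, ∑ _y : Y, δ / (Fintype.card X * Fintype.card Y + 1))
          + δ / (Fintype.card X * Fintype.card Y + 1) := by
          refine add_le_add (Finset.sum_le_sum fun x _ => Finset.sum_le_sum fun y _ => hXY x y) ?_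
          exact max_le (by positivity) (by linarith)
      _ = δ := by
          simp only [Finset.sum_const, Finset.card_univ, nsmul_eq_mul]
          field_simp)
  simp only [hφ] at h
  linarith

variable {Dmin Dmax : ℝ}

/-- The half of continuity that comes from compactness: the joint law of a near-minimizer at `D'`
has the exact marginal `P` and violates the distortion constraint at `D` by at most `δ`. -/
theorem exists_toReal_sub_le_of_le_add (hb : 1 < b) (hP : P ∈ stdSimplex ℝ (X × Y))
    (hfin : ∀ D ∈ Icc Dmin Dmax, singleLetterLeakage b P d D ≠ ⊤) (D : ℝ)
    {ε : ℝ} (hε : 0 < ε) :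
    ∃ δ > 0, ∀ D' ∈ Icc Dmin Dmax, D' ≤ D + δ →
      (singleLetterLeakage b P d D).toReal - ε ≤ (singleLetterLeakage b P d D').toReal := by
  obtain ⟨δ, hδ, h⟩ := exists_forall_le_perspectiveInfo (d := d) hb hP D hε
  refine ⟨δ, hδ, fun D' hD' hle => le_of_forall_pos_le_add fun η hη => ?_⟩
  obtain ⟨W, hW, hWD, hWl⟩ := exists_leakage_le_toReal_add hb hP (hfin D' hD') hη
  have hsum : ∑ a : X × Y × Z, P (a.1, a.2.1) * W a.1 a.2.1 a.2.2 = 1 := by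
    rw [← (outputLaw_mem_stdSimplex hP hW).2, ← sum_marginalYZ]
    rfl
  have hdist : ∑ a : X × Y × Z, P (a.1, a.2.1) * W a.1 a.2.1 a.2.2 * d a.1 a.2.2
      = expect P W d := by
    rw [Fintype.sum_prod_type]
    exact Finset.sum_congr rfl fun x _ => Fintype.sum_prod_type _
  have h1 := h (fun a => P (a.1, a.2.1) * W a.1 a.2.1 a.2.2)
    (fun a => mul_nonneg (hP.1 _) ((hW _ _).1 _)) hsum.le (fun x y => by
      rw [hsum]
      simp only [← Finset.mul_sum, (hW _ _).2]
      simpa using hδ.le) (by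
      rw [hsum, hdist]
      linarith)
  rw [hsum, one_mul] at h1
  have h2 : perspectiveInfo b (marginalYZ fun a : X × Y × Z => P (a.1, a.2.1) * W a.1 a.2.1 a.2.2)
      = leakage b P W := by
    rw [perspectiveInfo, sum_marginalYZ, hsum, Real.logb_one, mul_zero, add_zero]
    rfl
  linarith

/-- The half of continuity that comes from convexity: mixing in a small share `s` of a mechanism for
`Dmin` lowers the distortion level strictly and costs at most `s L(Dmin)`, which is small since
`L(Dmin)` is finite. -/
theorem exists_lt_toReal_le_add (hb : 1 < b) (hP : P ∈ stdSimplex ℝ (X × Y))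
    (hfin : ∀ D ∈ Icc Dmin Dmax, singleLetterLeakage b P d D ≠ ⊤) {D : ℝ} (hD : D ∈ Ioc Dmin Dmax)
    {ε : ℝ} (hε : 0 < ε) :
    ∃ D' ∈ Ico Dmin D, (singleLetterLeakage b P d D').toReal
      ≤ (singleLetterLeakage b P d D).toReal + ε := by
  set M := (singleLetterLeakage b P d Dmin).toReal with hM
  have hM0 : 0 ≤ M := toReal_singleLetterLeakage_nonneg hb hP _
  have hDmin : Dmin ≤ Dmax := hD.1.le.trans hD.2
  set s : ℝ := min 1 (ε / 2 / (M + 1)) with hs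
  have hs0 : 0 < s := lt_min one_pos (by positivity)
  have hs1 : s ≤ 1 := min_le_left _ _
  have hsM : s * M ≤ ε / 2 := by
    calc s * M ≤ ε / 2 / (M + 1) * (M + 1) :=
          mul_le_mul (min_le_right _ _) (by linarith) hM0 (by positivity)
      _ = ε / 2 := by field_simp
  obtain ⟨W, hW, hWD, hWl⟩ := exists_leakage_le_convex_comb hb hP
    (hfin Dmin ⟨le_rfl, hDmin⟩) (hfin D ⟨hD.1.le, hD.2⟩) ⟨hs0.le, hs1⟩ (half_pos hε)
  refine ⟨s * Dmin + (1 - s) * D, ⟨?_, ?_⟩,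
    (toReal_singleLetterLeakage_le hb hP hW hWD).trans ?_⟩
  · nlinarith [hD.1]
  · nlinarith [hD.1]
  · have h0 : 0 ≤ (singleLetterLeakage b P d D).toReal := toReal_singleLetterLeakage_nonneg hb hP _
    nlinarith

theorem continuousOn_toReal_singleLetterLeakage (hb : 1 < b) (hP : P ∈ stdSimplex ℝ (X × Y))
    (hfin : ∀ D ∈ Icc Dmin Dmax, singleLetterLeakage b P d D ≠ ⊤) :
    ContinuousOn (fun D => (singleLetterLeakage b P d D).toReal) (Icc Dmin Dmax) := by
  rw [Metric.continuousOn_iff]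
  intro D hD ε hε
  obtain ⟨δ, hδ, h⟩ := exists_toReal_sub_le_of_le_add hb hP hfin D (half_pos hε)
  obtain ⟨η, hη, h'⟩ : ∃ η > 0, ∀ D' ∈ Icc Dmin Dmax, D - η < D' →
      (singleLetterLeakage b P d D').toReal ≤ (singleLetterLeakage b P d D).toReal + ε / 2 := by
    rcases hD.1.eq_or_lt with h0 | h0
    · refine ⟨1, one_pos, fun D' hD' _ => ?_⟩
      have := toReal_singleLetterLeakage_anti hb hP (hfin D hD) (h0.symm.le.trans hD'.1)
      linarith
    · obtain ⟨D₁, hD₁, hle⟩ := exists_lt_toReal_le_add hb hP hfin ⟨h0, hD.2⟩ (half_pos hε)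
      refine ⟨D - D₁, sub_pos.2 hD₁.2, fun D' hD' hlt => ?_⟩
      exact (toReal_singleLetterLeakage_anti hb hP (hfin D₁ ⟨hD₁.1, hD₁.2.le.trans hD.2⟩)
        (by linarith)).trans hle
  refine ⟨min δ η, lt_min hδ hη, fun D' hD' hdist => ?_⟩
  rw [Real.dist_eq] at hdist ⊢
  have h1 := abs_lt.1 (hdist.trans_le (min_le_left _ _))
  have h2 := abs_lt.1 (hdist.trans_le (min_le_right _ _))
  have h3 := h D' hD' (by linarith)
  have h4 := h' D' hD' (by linarith)
  rw [abs_lt]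
  constructor <;> linarith

end SingleLetter

/-! ### Average letter laws on the cells of a partition -/

section CellType

variable {Ω A ι : Type*} [Fintype Ω] {n : ℕ}

open Classical in
/-- The average over `i` of the law of the `i`-th letter `s ω i` on the cell `U ω = u`. It is not
normalized: its total mass is the mass of the cell. -/
noncomputable def cellType (M : Ω → ℝ) (s : Ω → Fin n → A) (U : Ω → ι) (u : ι) : A → ℝ :=
  fun a => (∑ ω, if U ω = u then M ω * ∑ i, (if s ω i = a then 1 else 0) else 0) / n

open Classical in
theorem sum_cellType_mul [Fintype A] (M : Ω → ℝ) (s : Ω → Fin n → A) (U : Ω → ι) (u : ι)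
    (f : A → ℝ) : ∑ a, cellType M s U u a * f a
      = (∑ ω, if U ω = u then M ω * ∑ i, f (s ω i) else 0) / n := by
  simp only [cellType, div_mul_eq_mul_div]
  rw [← Finset.sum_div]
  congr 1
  simp_rw [Finset.sum_mul]
  rw [Finset.sum_comm]
  refine Finset.sum_congr rfl fun ω _ => ?_
  split_ifs
  · simp_rw [mul_assoc, ← Finset.mul_sum, Finset.sum_mul]
    rw [Finset.sum_comm]
    simp
  · simp

open Classical in
theorem sum_cellType [Fintype A] (hn : n ≠ 0) (M : Ω → ℝ) (s : Ω → Fin n → A) (U : Ω → ι)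
    (u : ι) : ∑ a, cellType M s U u a = ∑ ω, if U ω = u then M ω else 0 := by
  have h := sum_cellType_mul M s U u (fun _ => 1)
  simp only [mul_one] at h
  rw [h, Finset.sum_div]
  refine Finset.sum_congr rfl fun ω _ => ?_
  have hn' : (n : ℝ) ≠ 0 := Nat.cast_ne_zero.2 hn
  split_ifs
  · simp [hn']
  · simp

theorem sum_sum_cellType_mul [Fintype A] [Fintype ι] (M : Ω → ℝ) (s : Ω → Fin n → A) (U : Ω → ι)
    (f : ι → A → ℝ) : ∑ u, ∑ a, cellType M s U u a * f u a
      = (∑ ω, M ω * ∑ i, f (U ω) (s ω i)) / n := by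
  classical
  simp_rw [sum_cellType_mul]
  rw [← Finset.sum_div, Finset.sum_comm]
  simp

theorem sum_sum_cellType_mul_left [Fintype A] [Fintype ι] (hn : n ≠ 0) (M : Ω → ℝ)
    (s : Ω → Fin n → A) (U : Ω → ι) (f : ι → ℝ) :
    ∑ u, (∑ a, cellType M s U u a) * f u = ∑ ω, M ω * f (U ω) := by
  simp_rw [Finset.sum_mul]
  rw [sum_sum_cellType_mul M s U (fun u _ => f u), Finset.sum_div]
  have hn' : (n : ℝ) ≠ 0 := Nat.cast_ne_zero.2 hn
  refine Finset.sum_congr rfl fun ω _ => ?_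
  simp
  field_simp

theorem cellType_nonneg {M : Ω → ℝ} (hM : ∀ ω, 0 ≤ M ω) (s : Ω → Fin n → A) (U : Ω → ι) (u : ι)
    (a : A) : 0 ≤ cellType M s U u a := by
  refine div_nonneg (Finset.sum_nonneg fun ω _ => ?_) n.cast_nonneg
  split_ifs
  · exact mul_nonneg (hM ω) (Finset.sum_nonneg fun i _ => by split_ifs <;> simp)
  · exact le_rfl

/-- Ensures that the reverse channels built from cell types are positive at every letter of a
charged outcome. -/
theorem cellType_pos {M : Ω → ℝ} (hM : ∀ ω, 0 ≤ M ω) (s : Ω → Fin n → A) (U : Ω → ι) {ω : Ω}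
    (hω : 0 < M ω) (i : Fin n) : 0 < cellType M s U (U ω) (s ω i) := by
  classical
  refine div_pos ?_ (Nat.cast_pos.2 i.pos)
  refine Finset.sum_pos' (fun ω' _ => ?_) ⟨ω, Finset.mem_univ ω, ?_⟩
  · split_ifs
    · exact mul_nonneg (hM ω') (Finset.sum_nonneg fun i _ => by split_ifs <;> simp)
    · exact le_rfl
  · rw [if_pos rfl]
    refine mul_pos hω (Finset.sum_pos' (fun j _ => by split_ifs <;> simp)
      ⟨i, Finset.mem_univ i, by simp⟩)

theorem exists_of_cellType_pos {M : Ω → ℝ} (hM : ∀ ω, 0 ≤ M ω) (s : Ω → Fin n → A) (U : Ω → ι)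
    {u : ι} {a : A} (h : 0 < cellType M s U u a) : ∃ ω i, 0 < M ω ∧ s ω i = a := by
  classical
  by_contra! hcon
  refine h.ne' ?_
  rw [cellType, div_eq_zero_iff]
  left
  refine Finset.sum_eq_zero fun ω _ => ?_
  split_ifs
  · rcases (hM ω).eq_or_lt with h0 | h0
    · simp [← h0]
    · simp [hcon ω _ h0]
  · rfl

end CellType

/-! ### Converse: from `n`-letter leakage to cell types -/

section Converse

variable {X Y Z : Type*}

theorem sum_marginalYZ_mul [Fintype X] [Fintype Y] [Fintype Z] (q : X × Y × Z → ℝ) (G : Y → Z → ℝ) :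
    ∑ y, ∑ z, marginalYZ q (y, z) * G y z = ∑ a, q a * G a.2.1 a.2.2 := by
  rw [Fintype.sum_prod_type (f := fun a : X × Y × Z => q a * G a.2.1 a.2.2), Finset.sum_comm]
  rw [← Fintype.sum_prod_type_right (f := fun a : Y × Z => marginalYZ q a * G a.1 a.2)]
  rw [Finset.sum_comm]
  refine Finset.sum_congr rfl fun a _ => ?_
  rw [marginalYZ, Finset.sum_mul]

/-- The law of `(X,Y,Z)` induced by a mechanism. -/
def jointLaw (P : X × Y → ℝ) (W : X → Y → Z → ℝ) : X × Y × Z → ℝ :=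
  fun a => P (a.1, a.2.1) * W a.1 a.2.1 a.2.2

theorem outputLaw_eq_marginalYZ [Fintype X] (P : X × Y → ℝ) (W : X → Y → Z → ℝ) :
    outputLaw P W = marginalYZ (jointLaw P W) := rfl

theorem expect_eq_sum_jointLaw [Fintype X] [Fintype Y] [Fintype Z] (P : X × Y → ℝ) (W : X → Y → Z → ℝ) (f : X → Z → ℝ) :
    expect P W f = ∑ a, jointLaw P W a * f a.1 a.2.2 := by
  rw [Fintype.sum_prod_type]
  exact Finset.sum_congr rfl fun x _ => (Fintype.sum_prod_type
    (fun c : Y × Z => jointLaw P W (x, c) * f x c.2)).symm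

theorem jointLaw_nonneg [Fintype Z] {P : X × Y → ℝ} (hP : ∀ a, 0 ≤ P a) {W : X → Y → Z → ℝ}
    (hW : IsMechanism W) (a : X × Y × Z) : 0 ≤ jointLaw P W a :=
  mul_nonneg (hP _) ((hW _ _).1 _)

theorem sum_jointLaw_mul [Fintype X] [Fintype Y] [Fintype Z] (P : X × Y → ℝ) {W : X → Y → Z → ℝ} (hW : IsMechanism W)
    (G : X → Y → ℝ) : ∑ a, jointLaw P W a * G a.1 a.2.1 = ∑ x, ∑ y, P (x, y) * G x y := by
  rw [Fintype.sum_prod_type]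
  refine Finset.sum_congr rfl fun x _ => ?_
  rw [Fintype.sum_prod_type]
  refine Finset.sum_congr rfl fun y _ => ?_
  simp only [jointLaw]
  rw [← Finset.sum_mul, ← Finset.mul_sum, (hW x y).2, mul_one]

theorem sum_jointLaw [Fintype X] [Fintype Y] [Fintype Z] {P : X × Y → ℝ} (hP : P ∈ stdSimplex ℝ (X × Y)) {W : X → Y → Z → ℝ}
    (hW : IsMechanism W) : ∑ a, jointLaw P W a = 1 := by
  have h := sum_jointLaw_mul P hW (fun _ _ => 1)
  simp only [mul_one] at h
  rw [h, ← Fintype.sum_prod_type, hP.2]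

/-- The sequence of triples of letters in a triple of sequences. -/
def letters {n : ℕ} (ω : (Fin n → X) × (Fin n → Y) × (Fin n → Z)) (i : Fin n) : X × Y × Z :=
  (ω.1 i, ω.2.1 i, ω.2.2 i)

variable {ι : Type*} [Fintype X] [Fintype Y] [Fintype Z] {n : ℕ} {P : X × Y → ℝ}
  {W : (Fin n → X) → (Fin n → Y) → (Fin n → Z) → ℝ}

/-- For every partition of the sample space into finitely many cells, the `n`-letter leakage
dominates, up to the logarithm of the number of cells, `n` times the single letter information of
the cell types. -/
theorem sum_perspectiveInfo_cellType_le [Fintype ι] [Nonempty ι] {b : ℝ} (hb : 1 < b)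
    (hP : P ∈ stdSimplex ℝ (X × Y)) (hW : IsMechanism W)
    (U : (Fin n → X) × (Fin n → Y) × (Fin n → Z) → ι) :
    ∑ u, perspectiveInfo b (marginalYZ (cellType (jointLaw (iidLaw P n) W) letters U u))
      ≤ (leakage b (iidLaw P n) W + Real.logb b (Fintype.card ι)) / n := by
  classical
  have hPn := iidLaw_mem_stdSimplex hP n
  set M := jointLaw (iidLaw P n) W with hM
  have hM0 : ∀ ω, 0 ≤ M ω := jointLaw_nonneg hPn.1 hW
  set q := cellType M letters U with hq
  have hq0 : ∀ u a, 0 ≤ q u a := fun u a => cellType_nonneg hM0 _ _ _ _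
  have hm0 : ∀ u a, 0 ≤ marginalYZ (q u) a := fun u a => Finset.sum_nonneg fun x _ => hq0 u _
  -- `V u` is the conditional law of `Y` given `Z` under the cell type `q u`.
  set V : ι → Y → Z → ℝ := fun u y z => marginalYZ (q u) (y, z) / ∑ y', marginalYZ (q u) (y', z)
    with hV
  have hV0 : ∀ u y z, 0 ≤ V u y z := fun u y z =>
    div_nonneg (hm0 _ _) (Finset.sum_nonneg fun _ _ => hm0 _ _)
  have hV1 : ∀ u z, ∑ y, V u y z ≤ 1 := fun u z => by
    simp only [hV]
    rw [← Finset.sum_div]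
    exact div_self_le_one _
  set PY : Y → ℝ := fun y => ∑ x, P (x, y) with hPY
  have hPY0 : ∀ y, 0 ≤ PY y := fun y => Finset.sum_nonneg fun _ _ => hP.1 _
  set F : ι → X × Y × Z → ℝ := fun u a => Real.logb b (V u a.2.1 a.2.2 / PY a.2.1) with hF
  have hc : (0 : ℝ) < Fintype.card ι := Nat.cast_pos.2 Fintype.card_pos
  -- The cell is not a function of `(y, z)`, so the test channel is the uniform mixture over all
  -- cells of the product channels. It dominates each product up to the factor `1 / card ι`, so not
  -- knowing the cell costs `logb b (card ι)` in total.
  set R : (Fin n → Y) → (Fin n → Z) → ℝ := fun y z =>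
    (∑ u, ∏ i, V u (y i) (z i)) / Fintype.card ι with hR
  have hPYpos : ∀ ω, 0 < M ω → ∀ i, 0 < PY (ω.2.1 i) := by
    intro ω hω i
    have h1 : 0 < iidLaw P n (ω.1, ω.2.1) := by
      refine (hPn.1 _).lt_of_ne' fun h => hω.ne' ?_
      rw [hM, jointLaw, h, zero_mul]
    exact sum_fst_pos hP.1 ((hP.1 (ω.1 i, ω.2.1 i)).lt_of_ne'
      (Finset.prod_ne_zero_iff.1 h1.ne' i (Finset.mem_univ i)))
  have hVpos : ∀ ω, 0 < M ω → ∀ i, 0 < V (U ω) (ω.2.1 i) (ω.2.2 i) := by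
    intro ω hω i
    have h1 : 0 < marginalYZ (q (U ω)) (ω.2.1 i, ω.2.2 i) :=
      (cellType_pos hM0 letters U hω i).trans_le
        (Finset.single_le_sum (f := fun x => q (U ω) (x, ω.2.1 i, ω.2.2 i))
          (fun x _ => hq0 _ _) (Finset.mem_univ (ω.1 i)))
    exact div_pos h1 (sum_fst_pos (hm0 _) h1)
  have hRge : ∀ u y z, (∏ i, V u (y i) (z i)) / Fintype.card ι ≤ R y z := fun u y z =>
    div_le_div_of_nonneg_right (Finset.single_le_sum (f := fun u => ∏ i, V u (y i) (z i))
      (fun u _ => Finset.prod_nonneg fun i _ => hV0 _ _ _) (Finset.mem_univ u)) hc.le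
  have hgibbs := le_mutualInfo_of_channel hb (Q := outputLaw (iidLaw P n) W)
    (outputLaw_mem_stdSimplex hPn hW).1 (R := R)
    (fun y z => div_nonneg (Finset.sum_nonneg fun u _ =>
      Finset.prod_nonneg fun i _ => hV0 _ _ _) hc.le)
    (fun z => by
      simp only [hR]
      rw [← Finset.sum_div, Finset.sum_comm, div_le_one hc]
      calc ∑ u, ∑ y : Fin n → Y, ∏ i, V u (y i) (z i) ≤ ∑ _u : ι, (1 : ℝ) := by
            refine Finset.sum_le_sum fun u _ => ?_
            rw [sum_pi_prod (fun i y => V u y (z i))]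
            exact Finset.prod_le_one (fun i _ => Finset.sum_nonneg fun _ _ => hV0 _ _ _)
              fun i _ => hV1 u (z i)
        _ = Fintype.card ι := by simp)
    (fun y z h => by
      obtain ⟨x, -, hx⟩ := Finset.exists_lt_of_sum_lt (s := Finset.univ) (f := fun _ => (0 : ℝ))
        (g := fun x => M (x, y, z)) (by rw [Finset.sum_const_zero]; exact h)
      exact (div_pos (Finset.prod_pos fun i _ => hVpos (x, y, z) hx i) hc).trans_le
        (hRge (U (x, y, z)) y z))
  rw [← leakage_eq, outputLaw_eq_marginalYZ, ← hM] at hgibbs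
  rw [sum_marginalYZ_mul M (fun y z => Real.logb b (R y z / ∑ z', marginalYZ M (y, z')))] at hgibbs
  have hYn : ∀ y, ∑ z', marginalYZ M (y, z') = ∏ i, PY (y i) := fun y => by
    rw [hM, ← outputLaw_eq_marginalYZ, sum_outputLaw _ hW, sum_fst_iidLaw]
  have hpt : ∀ ω, M ω * (∑ i, F (U ω) (letters ω i)) - M ω * Real.logb b (Fintype.card ι)
      ≤ M ω * Real.logb b (R ω.2.1 ω.2.2 / ∑ z', marginalYZ M (ω.2.1, z')) := by
    intro ω
    rcases (hM0 ω).eq_or_lt with h0 | h0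
    · simp [← h0]
    rw [← mul_sub, hYn]
    refine mul_le_mul_of_nonneg_left ?_ h0.le
    have h1 : ∑ i, F (U ω) (letters ω i)
        = Real.logb b ((∏ i, V (U ω) (ω.2.1 i) (ω.2.2 i)) / ∏ i, PY (ω.2.1 i)) := by
      rw [← Finset.prod_div_distrib, Real.logb_prod]
      · rfl
      · exact fun i _ => (div_pos (hVpos ω h0 i) (hPYpos ω h0 i)).ne'
    have h2 : 0 < ∏ i, V (U ω) (ω.2.1 i) (ω.2.2 i) := Finset.prod_pos fun i _ => hVpos ω h0 i
    have h3 : 0 < ∏ i, PY (ω.2.1 i) := Finset.prod_pos fun i _ => hPYpos ω h0 i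
    rw [h1, ← Real.logb_div (by positivity) (by positivity)]
    refine Real.logb_le_logb_of_le hb (by positivity) ?_
    rw [div_right_comm]
    exact div_le_div_of_nonneg_right (hRge _ _ _) h3.le
  have hsum := (Finset.sum_le_sum fun ω (_ : ω ∈ Finset.univ) => hpt ω).trans hgibbs
  rw [Finset.sum_sub_distrib, ← Finset.sum_mul, sum_jointLaw hPn hW, one_mul] at hsum
  -- Conditioning on a cell may distort the `Y` marginal; keeping the original `PY` in the log ratio
  -- only increases the sum.
  have hcell : ∀ u, perspectiveInfo b (marginalYZ (q u)) ≤ ∑ a, q u a * F u a := by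
    intro u
    refine (perspectiveInfo_le hb (hm0 u) hPY0 ?_ ?_).trans_eq
      (sum_marginalYZ_mul (q u) (fun y z => Real.logb b (V u y z / PY y)))
    · rw [← Fintype.sum_prod_type_right, hP.2]
    · intro y z h
      obtain ⟨x, -, hx⟩ := Finset.exists_lt_of_sum_lt (s := Finset.univ) (f := fun _ => (0 : ℝ))
        (g := fun x => q u (x, y, z)) (by rw [Finset.sum_const_zero]; exact h)
      obtain ⟨ω, i, hω, hi⟩ := exists_of_cellType_pos hM0 letters U hx
      have h1 : ω.2.1 i = y := congrArg (fun a => a.2.1) hi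
      exact h1 ▸ hPYpos ω hω i
  refine (Finset.sum_le_sum fun u _ => hcell u).trans ?_
  rw [sum_sum_cellType_mul]
  exact div_le_div_of_nonneg_right (by linarith) n.cast_nonneg

/-- For the sum `S`, integrate `|S| ≤ S² / (2√n) + √n / 2` and use that `S` has second moment at
most `n`. -/
theorem sum_iidLaw_mul_abs_le {A B : Type*} [Fintype A] [Fintype B] {P : A × B → ℝ}
    (hP : P ∈ stdSimplex ℝ (A × B)) {h : A × B → ℝ} (hh : ∑ a, P a * h a = 0)
    (h1 : ∑ a, P a * h a ^ 2 ≤ 1) {n : ℕ} (hn : n ≠ 0) :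
    ∑ x, ∑ y, iidLaw P n (x, y) * |∑ i, h (x i, y i)| ≤ √n := by
  have hn' : (0 : ℝ) < n := Nat.cast_pos.2 (Nat.pos_of_ne_zero hn)
  have hs : 0 < √(n : ℝ) := Real.sqrt_pos.2 hn'
  rw [sum_iidLaw_mul P n (fun x y => |∑ i, h (x i, y i)|)]
  have hp : ∀ a : Fin n → A × B, 0 ≤ ∏ i, P (a i) := fun a => Finset.prod_nonneg fun i _ => hP.1 _
  calc ∑ a : Fin n → A × B, (∏ i, P (a i)) * |∑ i, h ((a i).1, (a i).2)|
      ≤ ∑ a : Fin n → A × B, ((∏ i, P (a i)) * (∑ i, h (a i)) ^ 2 * (1 / (2 * √n))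
          + (∏ i, P (a i)) * (√n / 2)) := by
        refine Finset.sum_le_sum fun a _ => ?_
        rw [mul_assoc, ← mul_add]
        refine mul_le_mul_of_nonneg_left ?_ (hp a)
        have h2 := sq_nonneg (|∑ i, h (a i)| - √n)
        rw [← sq_abs]
        rw [mul_one_div, ← sub_nonneg]
        have h3 : |∑ i, h (a i)| ^ 2 / (2 * √n) + √n / 2 - |∑ i, h ((a i).1, (a i).2)|
            = (|∑ i, h (a i)| - √n) ^ 2 / (2 * √n) := by
          simp only [Prod.mk.eta]
          field_simp
          ring
        rw [h3]
        positivity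
    _ = n * (∑ a, P a * h a ^ 2) * (1 / (2 * √n)) + √n / 2 := by
        rw [Finset.sum_add_distrib, ← Finset.sum_mul, ← Finset.sum_mul,
          sum_pi_prod_mul_sum_sq hP.2 hh, sum_pi_prod (fun _ => P)]
        simp [hP.2]
    _ ≤ n * 1 * (1 / (2 * √n)) + √n / 2 := by gcongr
    _ = √n := by
        have h4 : (n : ℝ) = √n * √n := (Real.mul_self_sqrt hn'.le).symm
        nth_rewrite 1 [h4]
        field_simp
        norm_num

/-- The difference is a cell average of the centred indicator `h` of `(x, y)`. Taking absolute
values removes the restriction to the cell, and then the mechanism drops out because `h` sees only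
`X` and `Y`. Hence the bound holds for every partition and every mechanism. -/
theorem abs_sum_cellType_sub_le (hP : P ∈ stdSimplex ℝ (X × Y)) (hn : n ≠ 0) (hW : IsMechanism W)
    (U : (Fin n → X) × (Fin n → Y) × (Fin n → Z) → ι) (u : ι) (x : X) (y : Y) :
    |∑ z, cellType (jointLaw (iidLaw P n) W) letters U u (x, y, z)
      - (∑ a, cellType (jointLaw (iidLaw P n) W) letters U u a) * P (x, y)| ≤ 1 / √n := by
  classical
  have hn' : (0 : ℝ) < n := Nat.cast_pos.2 (Nat.pos_of_ne_zero hn)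
  have hPn := iidLaw_mem_stdSimplex hP n
  set M := jointLaw (iidLaw P n) W with hM
  have hM0 : ∀ ω, 0 ≤ M ω := jointLaw_nonneg hPn.1 hW
  set h : X × Y → ℝ := fun c => (if c = (x, y) then 1 else 0) - P (x, y) with hh
  have h0 : ∑ c, P c * h c = 0 := by
    simp only [hh, mul_sub, Finset.sum_sub_distrib, ← Finset.sum_mul, hP.2]
    simp
  have hP1 : P (x, y) ≤ 1 := by
    rw [← hP.2]
    exact Finset.single_le_sum (fun c _ => hP.1 c) (Finset.mem_univ (x, y))
  have hsq : ∑ c, P c * h c ^ 2 ≤ 1 := by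
    rw [← hP.2]
    refine Finset.sum_le_sum fun c _ => mul_le_of_le_one_right (hP.1 c) ?_
    have := hP.1 (x, y)
    simp only [hh]
    split_ifs <;> nlinarith
  have hdiff : ∑ z, cellType M letters U u (x, y, z) - (∑ a, cellType M letters U u a) * P (x, y)
      = ∑ a, cellType M letters U u a * h (a.1, a.2.1) := by
    simp only [hh, mul_sub, Finset.sum_sub_distrib, ← Finset.sum_mul]
    congr 1
    rw [Fintype.sum_prod_type, Finset.sum_eq_single x, Fintype.sum_prod_type,
      Finset.sum_eq_single y]
    · simp
    · intro y' _ hy'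
      simp [hy']
    · simp
    · intro x' _ hx'
      simp [hx']
    · simp
  rw [hdiff, sum_cellType_mul M letters U u (fun a => h (a.1, a.2.1)), abs_div, Nat.abs_cast,
    div_le_iff₀ hn']
  calc |∑ ω, if U ω = u then M ω * ∑ i, h ((letters ω i).1, (letters ω i).2.1) else 0|
      ≤ ∑ ω, M ω * |∑ i, h (ω.1 i, ω.2.1 i)| := by
        refine (Finset.abs_sum_le_sum_abs _ _).trans (Finset.sum_le_sum fun ω _ => ?_)
        split_ifs
        · rw [abs_mul, abs_of_nonneg (hM0 ω)]
          exact le_rfl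
        · rw [abs_zero]
          exact mul_nonneg (hM0 ω) (abs_nonneg _)
    _ ≤ √n := by
        rw [hM, sum_jointLaw_mul _ hW (fun x y => |∑ i, h (x i, y i)|)]
        exact sum_iidLaw_mul_abs_le hP h0 hsq hn
    _ = 1 / √n * n := by
        rw [one_div, inv_mul_eq_div, Real.div_sqrt]

theorem sum_cellType_mul_distortion_le (hP : P ∈ stdSimplex ℝ (X × Y)) (hn : n ≠ 0)
    (hW : IsMechanism W) (U : (Fin n → X) × (Fin n → Y) × (Fin n → Z) → ι) {d : X → Z → ℝ}
    {t : ι → ℝ} (hU : ∀ ω, seqDistortion d n ω.1 ω.2.2 ≤ t (U ω)) (u : ι) :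
    ∑ a, cellType (jointLaw (iidLaw P n) W) letters U u a * d a.1 a.2.2
      ≤ (∑ a, cellType (jointLaw (iidLaw P n) W) letters U u a) * t u := by
  classical
  rw [sum_cellType_mul _ letters U u (fun a => d a.1 a.2.2), sum_cellType hn, Finset.sum_div,
    Finset.sum_mul]
  refine Finset.sum_le_sum fun ω _ => ?_
  split_ifs with h
  · rw [mul_div_assoc, ← h]
    exact mul_le_mul_of_nonneg_left (hU ω) (jointLaw_nonneg (iidLaw_mem_stdSimplex hP n).1 hW ω)
  · simp

end Converse

theorem seqDistortion_mem_Icc {X Z : Type*} {d : X → Z → ℝ} {Dmin Dmax : ℝ}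
    (hd : ∀ x z, d x z ∈ Icc Dmin Dmax) {n : ℕ} (hn : n ≠ 0)
    (x : Fin n → X) (z : Fin n → Z) : seqDistortion d n x z ∈ Icc Dmin Dmax := by
  have hn' : (0 : ℝ) < n := Nat.cast_pos.2 (Nat.pos_of_ne_zero hn)
  rw [seqDistortion]
  constructor
  · rw [le_div_iff₀ hn']
    calc Dmin * n = ∑ _i : Fin n, Dmin := by simp [mul_comm]
      _ ≤ _ := Finset.sum_le_sum fun i _ => (hd _ _).1
  · rw [div_le_iff₀ hn']
    calc ∑ i, d (x i) (z i) ≤ ∑ _i : Fin n, Dmax := Finset.sum_le_sum fun i _ => (hd _ _).2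
      _ = Dmax * n := by simp [mul_comm]

/-! ### Partition lower bound, and good memoryless mechanisms for one level -/

section Asymptotics

variable {X Y Z : Type*} [Fintype X] [Fintype Y] [Fintype Z] {b : ℝ} {P : X × Y → ℝ}
  {d : X → Z → ℝ} {Dmin Dmax : ℝ} {g : ℝ → ℝ}

theorem prob_eq_sum_jointLaw {P : X × Y → ℝ} (W : X → Y → Z → ℝ) (A : Set (X × Z)) :
    prob P W A = ∑ a, jointLaw P W a * A.indicator (fun _ => (1 : ℝ)) (a.1, a.2.2) :=
  expect_eq_sum_jointLaw P W _

/-- Minimality of `j` is what identifies, for monotone `t`, the event `j ≤ i` with `T ≤ t i`. -/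
theorem exists_level {t : ℕ → ℝ} {k : ℕ} {T : ℝ} (hT : T ≤ t k) :
    ∃ j : Fin (k + 1), T ≤ t j ∧ ∀ i < (j : ℕ), t i < T := by
  classical
  have h : ∃ j, T ≤ t j := ⟨k, hT⟩
  exact ⟨⟨Nat.find h, Nat.lt_succ_of_le (Nat.find_min' h hT)⟩, Nat.find_spec h,
    fun i hi => not_le.1 (Nat.find_min h hi)⟩

theorem sum_range_indicator_eq (ℓ : ℕ → ℝ) {j k : ℕ} (hjk : j ≤ k) :
    ∑ i ∈ Finset.range k, (ℓ i - ℓ (i + 1)) * (if j ≤ i then 1 else 0) = ℓ j - ℓ k := by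
  induction k, hjk using Nat.le_induction with
  | base =>
    rw [sub_self]
    refine Finset.sum_eq_zero fun i hi => ?_
    rw [if_neg (not_le.2 (Finset.mem_range.1 hi)), mul_zero]
  | succ k hk ih =>
    rw [Finset.sum_range_succ, ih, if_pos hk]
    ring

/-- Lower bound on the leakage of all mechanisms that respect the tail bound, in terms of a
partition of the distortion interval. -/
theorem eventually_le_leakage (hb : 1 < b) (hP : P ∈ stdSimplex ℝ (X × Y))
    (hd : ∀ x z, d x z ∈ Icc Dmin Dmax)
    (hfin : ∀ D ∈ Icc Dmin Dmax, singleLetterLeakage b P d D ≠ ⊤) {t : ℕ → ℝ} (ht : Monotone t)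
    (htI : ∀ i, t i ∈ Icc Dmin Dmax) {k : ℕ} (htk : t k = Dmax) {ε : ℝ} (hε : 0 < ε) :
    ∀ᶠ n : ℕ in atTop, ∀ W ∈ feasibleMechanisms P d Dmin Dmax g n,
      ∑ i ∈ Finset.range k, ((singleLetterLeakage b P d (t i)).toReal
        - (singleLetterLeakage b P d (t (i + 1))).toReal) * (1 - g (t i)) - ε
      ≤ 1 / (n : ℝ) * leakage b (iidLaw P n) W := by
  classical
  set ℓ : ℕ → ℝ := fun i => (singleLetterLeakage b P d (t i)).toReal with hℓ
  have hk : (0 : ℝ) < k + 1 := by positivity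
  -- Half of `ε` is spread over the `k + 1` cells; the other half absorbs the logarithmic cost of
  -- the partition.
  have hloc := fun u : Fin (k + 1) => exists_forall_le_perspectiveInfo (d := d) hb hP (t u)
    (show 0 < ε / 2 / (k + 1) by positivity)
  choose δ hδ hδq using hloc
  have hsqrt : Tendsto (fun n : ℕ => 1 / √(n : ℝ)) atTop (𝓝 0) :=
    (tendsto_const_nhds.div_atTop
      (Real.tendsto_sqrt_atTop.comp tendsto_natCast_atTop_atTop))
  have hlog : Tendsto (fun n : ℕ => Real.logb b (Fintype.card (Fin (k + 1))) / n) atTop (𝓝 0) :=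
    tendsto_const_nhds.div_atTop tendsto_natCast_atTop_atTop
  filter_upwards [eventually_all.2 fun u => hsqrt.eventually_le_const (hδ u),
    hlog.eventually_le_const (half_pos hε), eventually_ne_atTop 0] with n hn1 hn2 hn W hWf
  obtain ⟨hW, hWg⟩ := hWf
  have hPn := iidLaw_mem_stdSimplex hP n
  choose U hU hUlt using fun ω : (Fin n → X) × (Fin n → Y) × (Fin n → Z) =>
    exists_level (t := t) (k := k) (T := seqDistortion d n ω.1 ω.2.2)
      (htk ▸ (seqDistortion_mem_Icc hd hn _ _).2)
  have hmain := sum_perspectiveInfo_cellType_le hb hP hW U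
  set M := jointLaw (iidLaw P n) W with hM
  have hM0 : ∀ ω, 0 ≤ M ω := jointLaw_nonneg hPn.1 hW
  have hM1 : ∑ ω, M ω = 1 := sum_jointLaw hPn hW
  have hcell : ∀ u, (∑ a, cellType M letters U u a) * ℓ u - ε / 2 / (k + 1)
      ≤ perspectiveInfo b (marginalYZ (cellType M letters U u)) := by
    intro u
    refine hδq u _ (cellType_nonneg hM0 _ _ _) ?_
      (fun x y => (abs_sum_cellType_sub_le hP hn hW U u x y).trans (hn1 u)) ?_
    · rw [sum_cellType hn, ← hM1]
      refine Finset.sum_le_sum fun ω _ => ?_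
      split_ifs
      · exact le_rfl
      · exact hM0 ω
    · exact (sum_cellType_mul_distortion_le hP hn hW U (t := fun u => t u) hU u).trans
        (le_add_of_nonneg_right (hδ u).le)
  have h1 := (Finset.sum_le_sum fun u (_ : u ∈ Finset.univ) => hcell u).trans hmain
  rw [Finset.sum_sub_distrib, sum_sum_cellType_mul_left hn M letters U (fun u => ℓ u), add_div]
    at h1
  have h2 : ∑ _u : Fin (k + 1), ε / 2 / ((k : ℝ) + 1) = ε / 2 := by
    simp
    field_simp
  have hanti : ∀ i, 0 ≤ ℓ i - ℓ (i + 1) := fun i => sub_nonneg.2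
    (toReal_singleLetterLeakage_anti hb hP (hfin _ (htI i)) (ht i.le_succ))
  -- Summation by parts: the coefficients `ℓ i - ℓ (i + 1)` are nonnegative, so lower bounds on the
  -- probabilities of `U ≤ i` can be inserted term by term.
  have h3 : ∑ ω, M ω * ℓ (U ω) = ℓ k + ∑ i ∈ Finset.range k, (ℓ i - ℓ (i + 1)) *
      (∑ ω, M ω * (if (U ω : ℕ) ≤ i then 1 else 0)) := by
    have h4 : ∀ ω, M ω * ℓ (U ω) = M ω * ℓ k + ∑ i ∈ Finset.range k, (ℓ i - ℓ (i + 1)) *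
        (M ω * (if (U ω : ℕ) ≤ i then 1 else 0)) := by
      intro ω
      have h5 := sum_range_indicator_eq ℓ (Nat.lt_succ_iff.1 (U ω).2)
      have h6 : ∑ i ∈ Finset.range k, (ℓ i - ℓ (i + 1)) *
          (M ω * (if (U ω : ℕ) ≤ i then 1 else 0)) = M ω * (ℓ (U ω) - ℓ k) := by
        rw [← h5, Finset.mul_sum]
        exact Finset.sum_congr rfl fun i _ => by ring
      rw [h6]
      ring
    rw [Finset.sum_congr rfl fun ω _ => h4 ω, Finset.sum_add_distrib, ← Finset.sum_mul, hM1,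
      one_mul, Finset.sum_comm]
    simp_rw [Finset.mul_sum]
  have h7 : ∀ i, 1 - g (t i) ≤ ∑ ω, M ω * (if (U ω : ℕ) ≤ i then 1 else 0) := by
    intro i
    have h8 := hWg (t i) (htI i)
    rw [prob_eq_sum_jointLaw] at h8
    have h9 : ∑ ω, M ω * (if (U ω : ℕ) ≤ i then 1 else 0) + ∑ ω, M ω * indicator
        {xz : (Fin n → X) × (Fin n → Z) | t i < seqDistortion d n xz.1 xz.2} (fun _ => (1 : ℝ))
          (ω.1, ω.2.2) = 1 := by
      rw [← Finset.sum_add_distrib]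
      refine Eq.trans ?_ hM1
      refine Finset.sum_congr rfl fun ω _ => ?_
      by_cases h : (U ω : ℕ) ≤ i
      · rw [if_pos h, indicator_of_notMem, mul_one, mul_zero, add_zero]
        exact not_lt.2 ((hU ω).trans (ht h))
      · rw [if_neg h, indicator_of_mem, mul_one, mul_zero, zero_add]
        exact hUlt ω i (not_le.1 h)
    linarith
  have h10 : ∑ i ∈ Finset.range k, (ℓ i - ℓ (i + 1)) * (1 - g (t i)) ≤ ∑ ω, M ω * ℓ (U ω) := by
    rw [h3]
    have h11 : 0 ≤ ℓ k := toReal_singleLetterLeakage_nonneg hb hP _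
    refine le_trans ?_ (le_add_of_nonneg_left h11)
    exact Finset.sum_le_sum fun i _ => mul_le_mul_of_nonneg_left (h7 i) (hanti i)
  rw [one_div_mul_eq_div]
  linarith

/-- For every distortion level there is a memoryless mechanism with nearly minimal leakage that
exceeds the level with vanishing probability. -/
theorem exists_mechanism_eventually_prob_le (hb : 1 < b) (hP : P ∈ stdSimplex ℝ (X × Y))
    (hd : ∀ x z, d x z ∈ Icc Dmin Dmax)
    (hfin : ∀ D ∈ Icc Dmin Dmax, singleLetterLeakage b P d D ≠ ⊤) {D : ℝ} (hD : D ∈ Icc Dmin Dmax)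
    {ε δ : ℝ} (hε : 0 < ε) (hδ : 0 < δ) :
    ∃ W : X → Y → Z → ℝ, IsMechanism W ∧
      leakage b P W ≤ (singleLetterLeakage b P d D).toReal + ε ∧
      ∀ᶠ n : ℕ in atTop, prob (iidLaw P n) (memoryless W n)
        {xz | D < seqDistortion d n xz.1 xz.2} ≤ δ := by
  -- At `D = Dmin` there is no room below `D`. But the letter distortion is then at least `D` with
  -- mean at most `D`, so it equals `D` on the support and the level is never exceeded.
  rcases hD.1.eq_or_lt with h0 | h0
  · obtain ⟨W, hW, hWD, hWl⟩ := exists_leakage_le_toReal_add hb hP (hfin D hD) hε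
    refine ⟨W, hW, hWl, (eventually_ne_atTop 0).mono fun n hn => ?_⟩
    have hn' : (0 : ℝ) < n := Nat.cast_pos.2 (Nat.pos_of_ne_zero hn)
    rw [prob, expect_iidLaw_memoryless]
    refine le_of_eq_of_le (Finset.sum_eq_zero fun a _ => ?_) hδ.le
    by_cases hz : ∏ i, P ((a i).1, (a i).2.1) * W (a i).1 (a i).2.1 (a i).2.2 = 0
    · rw [hz, zero_mul]
    · rw [indicator_of_notMem, mul_zero]
      have hJ : ∀ c, jointLaw P W c * (d c.1 c.2.2 - D) = 0 := by
        have h1 : ∑ c, jointLaw P W c * (d c.1 c.2.2 - D) ≤ 0 := by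
          simp_rw [mul_sub]
          rw [Finset.sum_sub_distrib, ← Finset.sum_mul, sum_jointLaw hP hW,
            ← expect_eq_sum_jointLaw]
          linarith
        have h2 : ∀ c, 0 ≤ jointLaw P W c * (d c.1 c.2.2 - D) := fun c =>
          mul_nonneg (jointLaw_nonneg hP.1 hW c) (sub_nonneg.2 (h0 ▸ (hd _ _).1))
        intro c
        exact (Finset.sum_eq_zero_iff_of_nonneg fun c _ => h2 c).1
          (le_antisymm h1 (Finset.sum_nonneg fun c _ => h2 c)) c (Finset.mem_univ c)
      have hdD : ∀ i, d (a i).1 (a i).2.2 = D := fun i => sub_eq_zero.1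
        ((mul_eq_zero.1 (hJ (a i))).resolve_left
          (Finset.prod_ne_zero_iff.1 hz i (Finset.mem_univ i)))
      simp only [mem_ofPred_eq, seqDistortion, hdD, not_lt]
      simp [hn'.ne']
  -- Half of `ε` buys a mean distortion strictly below `D`; Chebyshev's inequality does the rest.
  · obtain ⟨D', hD', hle⟩ := exists_lt_toReal_le_add hb hP hfin ⟨h0, hD.2⟩ (half_pos hε)
    obtain ⟨W, hW, hWD, hWl⟩ := exists_leakage_le_toReal_add hb hP
      (hfin D' ⟨hD'.1, hD'.2.le.trans hD.2⟩) (half_pos hε)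
    refine ⟨W, hW, by linarith, ?_⟩
    set m := expect P W d with hm
    have hgap : 0 < D - m := by linarith [hD'.2]
    set F : X × Y × Z → ℝ := fun c => d c.1 c.2.2 - m with hF
    have hF0 : ∑ c, jointLaw P W c * F c = 0 := by
      simp only [hF, mul_sub]
      rw [Finset.sum_sub_distrib, ← Finset.sum_mul, sum_jointLaw hP hW,
        ← expect_eq_sum_jointLaw, one_mul, ← hm, sub_self]
    set V := ∑ c, jointLaw P W c * F c ^ 2 with hV
    have hlim : Tendsto (fun n : ℕ => V / (D - m) ^ 2 / n) atTop (𝓝 0) :=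
      tendsto_const_nhds.div_atTop tendsto_natCast_atTop_atTop
    filter_upwards [hlim.eventually_le_const hδ, eventually_ne_atTop 0] with n hn1 hn
    have hn' : (0 : ℝ) < n := Nat.cast_pos.2 (Nat.pos_of_ne_zero hn)
    refine le_trans ?_ hn1
    rw [prob, expect_iidLaw_memoryless]
    calc _ ≤ ∑ a : Fin n → X × Y × Z, (∏ i, jointLaw P W (a i)) * (∑ i, F (a i)) ^ 2
            * (1 / ((D - m) * n) ^ 2) := by
          refine Finset.sum_le_sum fun a _ => ?_
          rw [mul_assoc]
          refine mul_le_mul_of_nonneg_left ?_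
            (Finset.prod_nonneg fun i _ => jointLaw_nonneg hP.1 hW _)
          by_cases h : D < (∑ i, d (a i).1 (a i).2.2) / n
          swap
          · rw [indicator_of_notMem (by exact h)]
            positivity
          rw [indicator_of_mem (by exact h)]
          rw [lt_div_iff₀ hn'] at h
          have h1 : ∑ i, F (a i) = ∑ i, d (a i).1 (a i).2.2 - n * m := by
            simp [hF]
          rw [mul_one_div, le_div_iff₀ (by positivity), one_mul]
          have h2 : 0 < (D - m) * n := by positivity
          exact pow_le_pow_left₀ h2.le (by rw [h1]; linarith) 2
      _ = V / (D - m) ^ 2 / n := by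
          rw [← Finset.sum_mul, sum_pi_prod_mul_sum_sq (sum_jointLaw hP hW) hF0, ← hV]
          field_simp

end Asymptotics

/-! ### Achievability: time-sharing over the levels -/

section Achievability

variable {X Y Z : Type*} [Fintype X] [Fintype Y] [Fintype Z] {b : ℝ} {P : X × Y → ℝ}
  {d : X → Z → ℝ} {Dmin Dmax : ℝ} {g : ℝ → ℝ}

theorem prob_mono (hP : P ∈ stdSimplex ℝ (X × Y)) {W : X → Y → Z → ℝ} (hW : IsMechanism W)
    {A B : Set (X × Z)} (h : A ⊆ B) : prob P W A ≤ prob P W B := by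
  rw [prob_eq_sum_jointLaw, prob_eq_sum_jointLaw]
  exact Finset.sum_le_sum fun a _ => mul_le_mul_of_nonneg_left
    (indicator_le_indicator_of_subset h (fun _ => zero_le_one) _) (jointLaw_nonneg hP.1 hW a)

theorem prob_le_one (hP : P ∈ stdSimplex ℝ (X × Y)) {W : X → Y → Z → ℝ} (hW : IsMechanism W)
    (A : Set (X × Z)) : prob P W A ≤ 1 := by
  refine (prob_mono hP hW (subset_univ A)).trans_eq ?_
  rw [prob_eq_sum_jointLaw]
  simp [sum_jointLaw hP hW]

/-- The tail of the time-sharing weights of the mechanisms for the levels `0, …, k`. -/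
noncomputable def tailWeight (γ : ℕ → ℝ) (k : ℕ) (δ : ℝ) (j : ℕ) : ℝ :=
  if j = 0 then 1 else if j ≤ k then γ j - δ else 0

theorem tailWeight_succ_le {γ : ℕ → ℝ} (hγ : Antitone γ) (hγ1 : ∀ i, γ i ≤ 1) {k : ℕ} {δ : ℝ}
    (hδ0 : 0 ≤ δ) (hδ : δ ≤ γ k) (j : ℕ) : tailWeight γ k δ (j + 1) ≤ tailWeight γ k δ j := by
  have h1 := hγ1 (j + 1)
  have h2 := hγ (Nat.le_succ j)
  simp only [tailWeight, Nat.add_eq_zero_iff, one_ne_zero, and_false, if_false]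
  split_ifs with h3 h4 h5 h6
  · linarith
  · exact sub_le_sub_right h2 δ
  · omega
  · exact zero_le_one
  · linarith [hγ ‹j ≤ k›]
  · exact le_rfl

theorem tailWeight_mem_stdSimplex {γ : ℕ → ℝ} (hγ : Antitone γ) (hγ1 : ∀ i, γ i ≤ 1) {k : ℕ}
    {δ : ℝ} (hδ0 : 0 ≤ δ) (hδ : δ ≤ γ k) :
    (fun j : Fin (k + 1) => tailWeight γ k δ j - tailWeight γ k δ (j + 1))
      ∈ stdSimplex ℝ (Fin (k + 1)) := by
  refine ⟨fun j => sub_nonneg.2 (tailWeight_succ_le hγ hγ1 hδ0 hδ j), ?_⟩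
  rw [Fin.sum_univ_eq_sum_range (fun j => tailWeight γ k δ j - tailWeight γ k δ (j + 1)),
    Finset.sum_range_sub']
  simp [tailWeight]

/-- Level `j` carries weight `γ j - γ (j + 1)` for `j < k`, with an extra `1 - γ 0 + δ` at level
`0`. Level `k` costs nothing since `ℓ k = 0`; for `k = 0` it is the only level and the left side
vanishes. -/
theorem sum_tailWeight_mul_le {γ ℓ : ℕ → ℝ} (hγ1 : γ 0 ≤ 1) {k : ℕ} {δ : ℝ}
    (hδ0 : 0 ≤ δ) (hℓ0 : 0 ≤ ℓ 0) (hℓk : ℓ k = 0) :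
    ∑ j : Fin (k + 1), (tailWeight γ k δ j - tailWeight γ k δ (j + 1)) * ℓ j
      ≤ (1 - γ 0) * ℓ 0 + ∑ i ∈ Finset.range k, (γ i - γ (i + 1)) * ℓ i + δ * ℓ 0 := by
  rw [Fin.sum_univ_eq_sum_range
    (fun j => (tailWeight γ k δ j - tailWeight γ k δ (j + 1)) * ℓ j), Finset.sum_range_succ, hℓk,
    mul_zero, add_zero]
  have h : ∀ j ∈ Finset.range k, (tailWeight γ k δ j - tailWeight γ k δ (j + 1)) * ℓ j
      = (γ j - γ (j + 1)) * ℓ j + (if j = 0 then (1 - γ 0 + δ) * ℓ 0 else 0) := by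
    intro j hj
    have h1 := Finset.mem_range.1 hj
    rcases Nat.eq_zero_or_pos j with rfl | h0
    · have h2 : 1 ≤ k := h1
      simp [tailWeight, h2]
      ring
    · have h2 : j + 1 ≤ k := h1
      simp [tailWeight, h0.ne', h1.le, h2]
  rw [Finset.sum_congr rfl h, Finset.sum_add_distrib, Finset.sum_ite_eq']
  have h3 : 0 ≤ (1 - γ 0 + δ) * ℓ 0 := mul_nonneg (by linarith) hℓ0
  split_ifs <;> linarith

/-- Upper bound on the minimal leakage under the tail bound, in terms of a partition of the
distortion interval. -/
theorem eventually_exists_leakage_le (hb : 1 < b) (hP : P ∈ stdSimplex ℝ (X × Y))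
    (hd : ∀ x z, d x z ∈ Icc Dmin Dmax) (hg : IsTailBound Dmin Dmax g)
    (hfin : ∀ D ∈ Icc Dmin Dmax, singleLetterLeakage b P d D ≠ ⊤) {t : ℕ → ℝ} (ht : Monotone t)
    (htI : ∀ i, t i ∈ Icc Dmin Dmax) (ht0 : t 0 = Dmin) {k : ℕ} (htk : t k = Dmax) {ε : ℝ}
    (hε : 0 < ε) :
    ∀ᶠ n : ℕ in atTop, ∃ W ∈ feasibleMechanisms P d Dmin Dmax g n,
      1 / (n : ℝ) * leakage b (iidLaw P n) W
        ≤ (1 - g (t 0)) * (singleLetterLeakage b P d (t 0)).toReal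
          + ∑ i ∈ Finset.range k, (g (t i) - g (t (i + 1)))
            * (singleLetterLeakage b P d (t i)).toReal + ε := by
  set ℓ : ℕ → ℝ := fun i => (singleLetterLeakage b P d (t i)).toReal with hℓ
  set γ : ℕ → ℝ := fun i => g (t i) with hγdef
  have hγ : Antitone γ := fun i j hij => hg.antitoneOn (htI i) (htI j) (ht hij)
  have hγ1 : ∀ i, γ i ≤ 1 := fun i => (hg.mem_Ioc _ (htI i)).2
  have hγ0 : ∀ i, 0 < γ i := fun i => (hg.mem_Ioc _ (htI i)).1
  have hℓ0 : ∀ i, 0 ≤ ℓ i := fun i => toReal_singleLetterLeakage_nonneg hb hP _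
  have hℓk : ℓ k = 0 := by
    simp only [hℓ, htk]
    exact toReal_singleLetterLeakage_eq_zero hb hP (fun x z => (hd x z).2)
      (hfin _ (htk ▸ htI k))
  -- Positivity of `g` at `Dmax` makes room for `δ`. Shifting weight `δ` to level `0` costs `δ * ℓ
  -- 0`, half of the budget.
  obtain ⟨δ, hδ, hδγ, hδℓ⟩ : ∃ δ > 0, δ ≤ γ k ∧ δ * ℓ 0 ≤ ε / 2 := by
    refine ⟨min (γ k) (ε / 2 / (ℓ 0 + 1)), lt_min (hγ0 k) ?_, min_le_left _ _, ?_⟩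
    · have := hℓ0 0
      positivity
    · have h1 := hℓ0 0
      calc min (γ k) (ε / 2 / (ℓ 0 + 1)) * ℓ 0 ≤ ε / 2 / (ℓ 0 + 1) * (ℓ 0 + 1) :=
            mul_le_mul (min_le_right _ _) (by linarith) h1 (by positivity)
        _ = ε / 2 := by field_simp
  choose V hV hVl hVp using fun j : Fin (k + 1) =>
    exists_mechanism_eventually_prob_le hb hP hd hfin (htI j) (half_pos hε) hδ
  set w : Fin (k + 1) → ℝ := fun j => tailWeight γ k δ j - tailWeight γ k δ (j + 1) with hw
  have hwS : w ∈ stdSimplex ℝ (Fin (k + 1)) := tailWeight_mem_stdSimplex hγ hγ1 hδ.le hδγ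
  filter_upwards [eventually_all.2 hVp, eventually_ne_atTop 0] with n hn hn0
  have hn' : (0 : ℝ) < n := Nat.cast_pos.2 (Nat.pos_of_ne_zero hn0)
  have hPn := iidLaw_mem_stdSimplex hP n
  have hVn : ∀ j, IsMechanism (memoryless (V j) n) := fun j => isMechanism_memoryless (hV j) n
  refine ⟨mixture w fun j => memoryless (V j) n, ⟨isMechanism_mixture hwS hVn, ?_⟩, ?_⟩
  · intro D hD
    classical
    -- `m` is the first level above `D`, or `k + 1` if none of the levels up to `k` is. Components
    -- below `m` exceed `D` with probability at most `δ`; the others are charged their whole weight,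
    -- which sums to `tailWeight γ k δ m`.
    obtain ⟨m, hm1, hmk, hmlt, hmg⟩ : ∃ m, 1 ≤ m ∧ m ≤ k + 1 ∧ (∀ j < m, t j ≤ D) ∧
        tailWeight γ k δ m + δ ≤ g D := by
      have hex : ∃ m, m = k + 1 ∨ D < t m := ⟨k + 1, Or.inl rfl⟩
      have hm1 : 1 ≤ Nat.find hex := by
        rw [Nat.one_le_iff_ne_zero]
        intro h0
        have h1 := Nat.find_spec hex
        rw [h0] at h1
        rcases h1 with h1 | h1
        · omega
        · exact absurd h1 (not_lt.2 (ht0 ▸ hD.1))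
      refine ⟨Nat.find hex, hm1, Nat.find_min' hex (Or.inl rfl), fun j hj => ?_, ?_⟩
      · have h1 := Nat.find_min hex hj
        push Not at h1
        exact h1.2
      · have hDk : γ k ≤ g D :=
          hg.antitoneOn hD (htI k) (htk ▸ hD.2)
        rcases Nat.find_spec hex with h1 | h1
        · rw [h1]
          simp only [tailWeight, Nat.add_eq_zero_iff, one_ne_zero, and_false, if_false,
            Nat.not_succ_le_self, zero_add]
          linarith
        · have h2 : γ (Nat.find hex) ≤ g D := hg.antitoneOn hD (htI _) h1.le
          rw [tailWeight, if_neg (by omega)]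
          split_ifs <;> linarith
    have hprob : ∀ j, prob (iidLaw P n) (memoryless (V j) n)
        {xz | D < seqDistortion d n xz.1 xz.2} ≤ δ + (if m ≤ (j : ℕ) then 1 else 0) := by
      intro j
      split_ifs with h
      · linarith [prob_le_one hPn (hVn j) {xz | D < seqDistortion d n xz.1 xz.2}]
      · rw [add_zero]
        exact (prob_mono hPn (hVn j) fun xz hxz =>
          (hmlt j (not_le.1 h)).trans_lt hxz).trans (hn j)
    calc prob (iidLaw P n) (mixture w fun j => memoryless (V j) n)
          {xz | D < seqDistortion d n xz.1 xz.2}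
        = ∑ j, w j * prob (iidLaw P n) (memoryless (V j) n)
          {xz | D < seqDistortion d n xz.1 xz.2} := expect_mixture _ _ _ _
      _ ≤ ∑ j, w j * (δ + (if m ≤ (j : ℕ) then 1 else 0)) :=
          Finset.sum_le_sum fun j _ => mul_le_mul_of_nonneg_left (hprob j) (hwS.1 j)
      _ = δ + tailWeight γ k δ m := by
          simp_rw [mul_add]
          rw [Finset.sum_add_distrib, ← Finset.sum_mul, hwS.2, one_mul, Fin.sum_univ_eq_sum_range
            (fun j => (tailWeight γ k δ j - tailWeight γ k δ (j + 1)) * (if m ≤ j then 1 else 0)),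
            sum_range_indicator_eq _ hmk]
          simp [tailWeight]
      _ ≤ g D := by linarith
  · have h1 : 1 / (n : ℝ) * leakage b (iidLaw P n) (mixture w fun j => memoryless (V j) n)
        ≤ ∑ j, w j * leakage b P (V j) := by
      rw [one_div_mul_eq_div, div_le_iff₀ hn', Finset.sum_mul]
      refine (leakage_mixture_le hb hPn.1 hwS hVn).trans_eq
        (Finset.sum_congr rfl fun j _ => ?_)
      rw [leakage_memoryless b hP (hV j)]
      ring
    have h2 : ∑ j, w j * leakage b P (V j) ≤ ∑ j, w j * ℓ j + ε / 2 := by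
      calc ∑ j, w j * leakage b P (V j) ≤ ∑ j, w j * (ℓ j + ε / 2) :=
            Finset.sum_le_sum fun j _ => mul_le_mul_of_nonneg_left (hVl j) (hwS.1 j)
        _ = _ := by
            simp_rw [mul_add]
            rw [Finset.sum_add_distrib, ← Finset.sum_mul, hwS.2, one_mul]
    have h3 := sum_tailWeight_mul_le (k := k) (hγ1 0) hδ.le (hℓ0 0) hℓk
    linarith

end Achievability

/-! ### Riemann–Stieltjes sums for the measure of the tail bound -/

section Riemann

variable {Dmin Dmax : ℝ} {g : ℝ → ℝ}

theorem IsTailBound.stieltjes_apply (hg : IsTailBound Dmin Dmax g) (hD : Dmin ≤ Dmax) {D : ℝ}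
    (h : D ∈ Icc Dmin Dmax) : hg.stieltjes hD D = 1 - g D := by
  change (if D < Dmin then 0 else 1 - g (min D Dmax)) = 1 - g D
  rw [if_neg (not_lt.2 h.1), min_eq_left h.2]

theorem IsTailBound.measure_real_Ioc (hg : IsTailBound Dmin Dmax g) (hD : Dmin ≤ Dmax) {u v : ℝ}
    (hu : u ∈ Icc Dmin Dmax) (hv : v ∈ Icc Dmin Dmax) (huv : u ≤ v) :
    (hg.stieltjes hD).measure.real (Ioc u v) = g u - g v := by
  rw [measureReal_def, StieltjesFunction.measure_Ioc, hg.stieltjes_apply hD hu,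
    hg.stieltjes_apply hD hv, ENNReal.toReal_ofReal]
  · ring
  · linarith [hg.antitoneOn hu hv huv]

theorem IsTailBound.measure_real_singleton (hg : IsTailBound Dmin Dmax g) (hD : Dmin ≤ Dmax) :
    (hg.stieltjes hD).measure.real {Dmin} = 1 - g Dmin := by
  have hmem : Dmin ∈ Icc Dmin Dmax := ⟨le_rfl, hD⟩
  have hlim : Function.leftLim (hg.stieltjes hD) Dmin = 0 := by
    refine leftLim_eq_of_tendsto ?_
    refine tendsto_const_nhds.congr' ?_
    filter_upwards [self_mem_nhdsWithin] with D hD'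
    exact (if_pos hD').symm
  rw [measureReal_def, StieltjesFunction.measure_singleton, hlim, hg.stieltjes_apply hD hmem,
    sub_zero, ENNReal.toReal_ofReal]
  exact sub_nonneg.2 (hg.mem_Ioc _ hmem).2

/-- The integral of an antitone function against the measure of the tail bound lies between its
lower and upper Riemann–Stieltjes sums. -/
theorem IsTailBound.integral_mem_Icc (hg : IsTailBound Dmin Dmax g) (hD : Dmin ≤ Dmax) {f : ℝ → ℝ}
    (hf : AntitoneOn f (Icc Dmin Dmax)) {t : ℕ → ℝ} (ht : Monotone t)
    (htI : ∀ i, t i ∈ Icc Dmin Dmax) (ht0 : t 0 = Dmin) {k : ℕ} (htk : t k = Dmax) :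
    ∫ D in Icc Dmin Dmax, f D ∂(hg.stieltjes hD).measure ∈
      Icc ((1 - g (t 0)) * f (t 0) + ∑ i ∈ Finset.range k, (g (t i) - g (t (i + 1))) * f (t (i + 1)))
        ((1 - g (t 0)) * f (t 0) + ∑ i ∈ Finset.range k, (g (t i) - g (t (i + 1))) * f (t i)) := by
  set μ := (hg.stieltjes hD).measure with hμ
  have hint : IntegrableOn f (Icc Dmin Dmax) μ := hf.integrableOn_isCompact isCompact_Icc
  have hsub : ∀ i, Ioc (t i) (t (i + 1)) ⊆ Icc Dmin Dmax := fun i D hDi =>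
    ⟨(htI i).1.trans hDi.1.le, hDi.2.trans (htI (i + 1)).2⟩
  -- The point `Dmin` may be an atom and is split off; the half-open cells cover the rest without
  -- overlap.
  have hsplit : ∫ D in Icc Dmin Dmax, f D ∂μ
      = (1 - g (t 0)) * f (t 0) + ∑ i ∈ Finset.range k, ∫ D in Ioc (t i) (t (i + 1)), f D ∂μ := by
    have h1 : ∑ i ∈ Finset.range k, ∫ D in Ioc (t i) (t (i + 1)), f D ∂μ
        = ∫ D in Ioc Dmin Dmax, f D ∂μ := by
      rw [← intervalIntegral.integral_of_le hD, ← ht0, ← htk,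
        ← intervalIntegral.sum_integral_adjacent_intervals]
      · exact Finset.sum_congr rfl fun i _ =>
          (intervalIntegral.integral_of_le (ht i.le_succ)).symm
      · exact fun i _ => (intervalIntegrable_iff_integrableOn_Ioc_of_le (ht i.le_succ)).2
          (hint.mono_set (hsub i))
    rw [h1, ← Icc_union_Ioc_eq_Icc le_rfl hD, Icc_self, setIntegral_union (by simp)
      measurableSet_Ioc (hint.mono_set (by simpa using hD)) (hint.mono_set Ioc_subset_Icc_self),
      integral_singleton, hg.measure_real_singleton hD, ht0, smul_eq_mul]
  have hfinite : ∀ i, μ (Ioc (t i) (t (i + 1))) ≠ ⊤ := fun i => measure_Ioc_lt_top.ne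
  rw [hsplit]
  constructor
  · refine add_le_add_right (Finset.sum_le_sum fun i _ => ?_) _
    rw [← hg.measure_real_Ioc hD (htI i) (htI (i + 1)) (ht i.le_succ), ← smul_eq_mul,
      ← setIntegral_const]
    exact setIntegral_mono_on (integrableOn_const (hfinite i)) (hint.mono_set (hsub i))
      measurableSet_Ioc fun D hDi => hf (hsub i hDi) (htI (i + 1)) hDi.2
  · refine add_le_add_right (Finset.sum_le_sum fun i _ => ?_) _
    rw [← hg.measure_real_Ioc hD (htI i) (htI (i + 1)) (ht i.le_succ), ← smul_eq_mul,
      ← setIntegral_const]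
    exact setIntegral_mono_on (hint.mono_set (hsub i)) (integrableOn_const (hfinite i))
      measurableSet_Ioc fun D hDi => hf (htI i) (hsub i hDi) hDi.1.le

theorem exists_partition_of_continuousOn (hD : Dmin ≤ Dmax) {f : ℝ → ℝ}
    (hf : ContinuousOn f (Icc Dmin Dmax)) {ε : ℝ} (hε : 0 < ε) :
    ∃ (t : ℕ → ℝ) (k : ℕ), Monotone t ∧ (∀ i, t i ∈ Icc Dmin Dmax) ∧ t 0 = Dmin ∧ t k = Dmax ∧
      ∀ i, f (t i) - f (t (i + 1)) ≤ ε := by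
  obtain ⟨δ, hδ, h⟩ := Metric.uniformContinuousOn_iff.1
    (isCompact_Icc.uniformContinuousOn_of_continuous hf) ε hε
  obtain ⟨k, hk⟩ := exists_nat_ge ((Dmax - Dmin) / (δ / 2))
  have hstep : ∀ i : ℕ, Dmin + (i : ℝ) * (δ / 2) ≤ Dmin + ((i + 1 : ℕ) : ℝ) * (δ / 2) := by
    intro i
    push_cast
    linarith
  have hI : ∀ i : ℕ, min (Dmin + (i : ℝ) * (δ / 2)) Dmax ∈ Icc Dmin Dmax := fun i =>
    ⟨le_min (le_add_of_nonneg_right (by positivity)) hD, min_le_right _ _⟩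
  -- The step `δ / 2` keeps neighbours strictly within `δ`; capping at `Dmax` keeps all indices
  -- beyond `k` in the interval.
  refine ⟨fun i => min (Dmin + i * (δ / 2)) Dmax, k, monotone_nat_of_le_succ fun i =>
    min_le_min_right _ (hstep i), hI, by simpa using hD, ?_, fun i => ?_⟩
  · rw [div_le_iff₀ (by positivity)] at hk
    exact min_eq_right (by linarith)
  · refine (le_abs_self _).trans (h _ (hI i) _ (hI (i + 1)) ?_).le
    rw [Real.dist_eq, abs_sub_comm, abs_of_nonneg (sub_nonneg.2 (min_le_min_right _ (hstep i)))]
    have h1 : min (Dmin + ((i + 1 : ℕ) : ℝ) * (δ / 2)) Dmax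
        ≤ min (Dmin + (i : ℝ) * (δ / 2)) Dmax + δ / 2 := by
      rw [← min_add_add_right]
      refine min_le_min ?_ (by linarith)
      push_cast
      linarith
    linarith

/-- Abel summation turns the converse bound into a lower Riemann–Stieltjes sum; the boundary term
disappears in the application because `L` vanishes at `Dmax`. -/
theorem sum_range_sub_mul_one_sub (ℓ γ : ℕ → ℝ) (k : ℕ) :
    ∑ i ∈ Finset.range k, (ℓ i - ℓ (i + 1)) * (1 - γ i)
      = (1 - γ 0) * ℓ 0 + ∑ i ∈ Finset.range k, (γ i - γ (i + 1)) * ℓ (i + 1)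
        - (1 - γ k) * ℓ k := by
  induction k with
  | zero => simp
  | succ k ih =>
    rw [Finset.sum_range_succ, Finset.sum_range_succ, ih]
    ring

end Riemann

/-! ### The limit -/

theorem theorem4 {X Y Z : Type*} [Fintype X] [Fintype Y] [Fintype Z]
    (b : ℝ) (hb : 1 < b)
    (P : X × Y → ℝ) (hP : P ∈ stdSimplex ℝ (X × Y))
    (Dmin Dmax : ℝ) (hD : Dmin ≤ Dmax)
    (d : X → Z → ℝ) (hd : ∀ x z, d x z ∈ Icc Dmin Dmax)
    (g : ℝ → ℝ) (hg : IsTailBound Dmin Dmax g)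
    (hL : ∃ C : ℝ, ∀ D ∈ Icc Dmin Dmax, singleLetterLeakage b P d D ≤ (C : EReal)) :
    IntegrableOn (fun D => (singleLetterLeakage b P d D).toReal) (Icc Dmin Dmax)
        (hg.stieltjes hD).measure ∧
      Tendsto (fun n : ℕ => generalLeakage b P d Dmin Dmax g n) atTop
        (𝓝 ((∫ D in Icc Dmin Dmax, (singleLetterLeakage b P d D).toReal
          ∂(hg.stieltjes hD).measure : ℝ) : EReal)) := by
  obtain ⟨C, hC⟩ := hL
  have hfin : ∀ D ∈ Icc Dmin Dmax, singleLetterLeakage b P d D ≠ ⊤ := fun D hDI =>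
    ((hC D hDI).trans_lt (EReal.coe_lt_top C)).ne
  set f : ℝ → ℝ := fun D => (singleLetterLeakage b P d D).toReal with hf
  have hanti : AntitoneOn f (Icc Dmin Dmax) := fun u hu v _ huv =>
    toReal_singleLetterLeakage_anti hb hP (hfin u hu) huv
  have hcont : ContinuousOn f (Icc Dmin Dmax) :=
    continuousOn_toReal_singleLetterLeakage hb hP hfin
  have hfmax : f Dmax = 0 := toReal_singleLetterLeakage_eq_zero hb hP (fun x z => (hd x z).2)
    (hfin _ ⟨hD, le_rfl⟩)
  refine ⟨hanti.integrableOn_isCompact isCompact_Icc, ?_⟩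
  set I := ∫ D in Icc Dmin Dmax, f D ∂(hg.stieltjes hD).measure with hI
  have hpart : ∀ ε > 0, ∃ (t : ℕ → ℝ) (k : ℕ), Monotone t ∧ (∀ i, t i ∈ Icc Dmin Dmax) ∧
      t 0 = Dmin ∧ t k = Dmax ∧
      (1 - g (t 0)) * f (t 0) + ∑ i ∈ Finset.range k, (g (t i) - g (t (i + 1))) * f (t i)
        ≤ I + ε ∧
      I - ε ≤ ∑ i ∈ Finset.range k, (f (t i) - f (t (i + 1))) * (1 - g (t i)) := by
    intro ε hε
    obtain ⟨t, k, ht, htI, ht0, htk, hosc⟩ := exists_partition_of_continuousOn hD hcont hε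
    have hIcc := hg.integral_mem_Icc hD hanti ht htI ht0 htk
    -- Upper and lower sums differ by at most the oscillation `ε` times the total increment of `g`,
    -- which is at most `1`.
    have hgap : ∑ i ∈ Finset.range k, (g (t i) - g (t (i + 1))) * f (t i)
        ≤ ∑ i ∈ Finset.range k, (g (t i) - g (t (i + 1))) * f (t (i + 1)) + ε := by
      calc ∑ i ∈ Finset.range k, (g (t i) - g (t (i + 1))) * f (t i)
          ≤ ∑ i ∈ Finset.range k, ((g (t i) - g (t (i + 1))) * f (t (i + 1))
              + (g (t i) - g (t (i + 1))) * ε) := by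
            refine Finset.sum_le_sum fun i _ => ?_
            rw [← mul_add]
            refine mul_le_mul_of_nonneg_left (by linarith [hosc i]) ?_
            exact sub_nonneg.2 (hg.antitoneOn (htI i) (htI (i + 1)) (ht i.le_succ))
        _ = ∑ i ∈ Finset.range k, (g (t i) - g (t (i + 1))) * f (t (i + 1))
              + (g (t 0) - g (t k)) * ε := by
            rw [Finset.sum_add_distrib, ← Finset.sum_mul, Finset.sum_range_sub' (fun i => g (t i))]
        _ ≤ _ := by
            have h1 := (hg.mem_Ioc _ (htI 0)).2
            have h2 := (hg.mem_Ioc _ (htI k)).1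
            gcongr
            exact mul_le_of_le_one_left hε.le (by linarith)
    refine ⟨t, k, ht, htI, ht0, htk, ?_, ?_⟩
    · linarith [hIcc.1]
    · rw [sum_range_sub_mul_one_sub (fun i => f (t i)) (fun i => g (t i)), htk, hfmax, mul_zero,
        sub_zero]
      linarith [hIcc.2]
  refine tendsto_order.2 ⟨fun a ha => ?_, fun a ha => ?_⟩
  · obtain ⟨r, har, hrI⟩ := EReal.lt_iff_exists_real_btwn.1 ha
    -- One half of the gap pays for the partition, the other for finite `n`.
    have hε : 0 < (I - r) / 2 := half_pos (sub_pos.2 (EReal.coe_lt_coe_iff.1 hrI))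
    obtain ⟨t, k, ht, htI, -, htk, -, hlow⟩ := hpart _ hε
    filter_upwards [eventually_le_leakage (g := g) hb hP hd hfin ht htI htk hε] with n hn
    refine har.trans_le (le_iInf₂ fun W hW => EReal.coe_le_coe_iff.2 ?_)
    have h := hn W hW
    simp only [hf] at hlow
    linarith
  · obtain ⟨r, hIr, hra⟩ := EReal.lt_iff_exists_real_btwn.1 ha
    have hε : 0 < (r - I) / 2 := half_pos (sub_pos.2 (EReal.coe_lt_coe_iff.1 hIr))
    obtain ⟨t, k, ht, htI, ht0, htk, hup, -⟩ := hpart _ hε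
    filter_upwards [eventually_exists_leakage_le hb hP hd hg hfin ht htI ht0 htk hε]
      with n ⟨W, hW, hle⟩
    refine ((iInf₂_le W hW).trans (EReal.coe_le_coe_iff.2 ?_)).trans_lt hra
    simp only [hf] at hup
    linarith
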